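/- Let $\mathbf{HA}$ be intuitionistic first-order (Heyting) arithmetic in the language with equality and with function symbols for all primitive recursive functions; its non-logical axioms are the successor axioms, the defining equations of the primitive recursive functions, and the induction scheme for all formulas. Let $s<t$ be the quantifier-free formula $(s+1)\mathbin{\dot-}t=0$, and let $\exists y<x\,\varphi$ and $\forall y<x\,\varphi$ abbreviate $\exists y\,(y<x\land\varphi)$ and $\forall y\,(y<x\to\varphi)$. Let $\Sigma_0=\Pi_0$ be the set of quantifier-free formulas; for $k\ge 0$ let $\Sigma_{k+1}$ be the set of formulas $\exists x_1\cdots\exists x_n\,\varphi$ with $n\ge 1$ and $\varphi\in\Pi_k$, and let $\Pi_{k+1}$ be the set of formulas $\forall x_1\cdots\forall x_n\,\varphi$ with $n\ge 1$ and $\varphi\in\Sigma_k$. For $m<0$ let $\Sigma_m=\emptyset$. For a set $\Gamma$ of formulas, $\mathbf{DML}_\Gamma$ is the scheme $\neg(\varphi\land\psi)\to\neg\varphi\lor\neg\psi$ for $\varphi,\psi\in\Gamma$, and $\mathbf{DNE}_\Gamma$ is the scheme $\neg\neg\varphi\to\varphi$ for $\varphi\in\Gamma$. Write $T+P$ for the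 theory obtained from $T$ by adding the universal closures of all instances of the scheme $P$ as axioms. Let $k\ge 0$ be a natural number and let $x$ and $y$ be distinct variables. 1. For every $\Pi_k$ formula $\varphi$ there is a $\Pi_k$ formula $\psi$ with $\mathrm{FV}(\psi)\subseteq(\mathrm{FV}(\varphi)\setminus\{y\})\cup\{x\}$ such that $$\mathbf{HA}+\mathbf{DML}_{\Sigma_k}+\mathbf{DNE}_{\Sigma_{k-1}}\vdash\exists y<x\,\varphi\leftrightarrow\psi.$$ 2. For every $\Sigma_k$ formula $\varphi$ there is a $\Sigma_k$ formula $\psi$ with $\mathrm{FV}(\psi)\subseteq(\mathrm{FV}(\varphi)\setminus\{y\})\cup\{x\}$ such that $$\mathbf{HA}+\mathbf{DML}_{\Sigma_{k-1}}+\mathbf{DNE}_{\Sigma_{k-2}}\vdash\forall y<x\,\varphi\leftrightarrow\psi.$$ -/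

import Mathlib

namespace HeytingArithmetic

/-- Function symbols of the language of arithmetic: one symbol of arity `n` for every
primitive recursive definition of an `n`-ary function.  `prec f g` is the function `h` with
`h (0, xs) = f xs` and `h (y + 1, xs) = g (y, h (y, xs), xs)`. -/
inductive PRSymbol : ℕ → Type
  | zero : PRSymbol 0
  | succ : PRSymbol 1
  | proj {n : ℕ} (i : Fin n) : PRSymbol n
  | comp {m n : ℕ} (f : PRSymbol m) (g : Fin m → PRSymbol n) : PRSymbol n
  | prec {n : ℕ} (f : PRSymbol n) (g : PRSymbol (n + 2)) : PRSymbol (n + 1)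

/-- The language of first-order arithmetic; equality is its only predicate. -/
def arith : FirstOrder.Language.{0, 0} := ⟨PRSymbol, fun _ => Empty⟩

/-- Terms, with de Bruijn indices as variables. -/
abbrev Tm : Type := arith.Term ℕ

/-- Application of a function symbol. -/
def app {n : ℕ} (f : PRSymbol n) (ts : Fin n → Tm) : Tm :=
  FirstOrder.Language.Term.func (L := arith) f ts

/-- The variable with index `n`. -/
def v (n : ℕ) : Tm := FirstOrder.Language.Term.var n

/-- The constant `0`. -/
def zeroT : Tm := app PRSymbol.zero Fin.elim0

/-- The successor of a term. -/
def succT (t : Tm) : Tm := app PRSymbol.succ (fun _ => t)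

/-- The predecessor function. -/
def predS : PRSymbol 1 := PRSymbol.prec PRSymbol.zero (PRSymbol.proj 0)

/-- Truncated subtraction with its arguments exchanged: `rsubS (y, x) = x - y`. -/
def rsubS : PRSymbol 2 :=
  PRSymbol.prec (PRSymbol.proj 0) (PRSymbol.comp predS (fun _ => PRSymbol.proj 1))

/-- Formulas of intuitionistic arithmetic with all connectives primitive.  Variables are de Bruijn
indices: in `all φ` and `ex φ` the index `0` of `φ` is bound, and the index `n + 1` of `φ`
refers to the variable `n` outside. -/
inductive Fml : Type
  | bot : Fml
  | eq (s t : Tm) : Fml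
  | and (φ ψ : Fml) : Fml
  | or (φ ψ : Fml) : Fml
  | imp (φ ψ : Fml) : Fml
  | all (φ : Fml) : Fml
  | ex (φ : Fml) : Fml

namespace Fml

/-- Negation. -/
def neg (φ : Fml) : Fml := imp φ bot

/-- Bi-implication. -/
def iff (φ ψ : Fml) : Fml := and (imp φ ψ) (imp ψ φ)

/-- The formula `s < t`, that is, `(s + 1) - t = 0` with truncated subtraction. -/
def lt (s t : Tm) : Fml := eq (app rsubS ![t, succT s]) zeroT

/-- The set of free variables of a formula. -/
def fv : Fml → Finset ℕ
  | bot => ∅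
  | eq s t => s.varFinset ∪ t.varFinset
  | and φ ψ => fv φ ∪ fv ψ
  | or φ ψ => fv φ ∪ fv ψ
  | imp φ ψ => fv φ ∪ fv ψ
  | all φ => ((fv φ).erase 0).image Nat.pred
  | ex φ => ((fv φ).erase 0).image Nat.pred

end Fml

/-- The substitution that sends the variable `0` to `t` and the variable `n + 1` to `σ n`. -/
def scons (t : Tm) (σ : ℕ → Tm) : ℕ → Tm
  | 0 => t
  | n + 1 => σ n

/-- The substitution `σ` carried under a quantifier. -/
def up (σ : ℕ → Tm) : ℕ → Tm := scons (v 0) (fun n => (σ n).relabel Nat.succ)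

namespace Fml

/-- Simultaneous capture-avoiding substitution of `σ n` for the variable `n`. -/
def subst : Fml → (ℕ → Tm) → Fml
  | bot, _ => bot
  | eq s t, σ => eq (s.subst σ) (t.subst σ)
  | and φ ψ, σ => and (subst φ σ) (subst ψ σ)
  | or φ ψ, σ => or (subst φ σ) (subst ψ σ)
  | imp φ ψ, σ => imp (subst φ σ) (subst ψ σ)
  | all φ, σ => all (subst φ (up σ))
  | ex φ, σ => ex (subst φ (up σ))

/-- Renaming of every free variable `n` to `n + 1`, so that `0` becomes fresh. -/
def shift (φ : Fml) : Fml := φ.subst (fun n => v (n + 1))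

/-- Instantiation `φ(t)` of the variable bound by an outer quantifier: `0` is replaced by `t`
and `n + 1` by `n`. -/
def inst (φ : Fml) (t : Tm) : Fml := φ.subst (scons t v)

/-- The formula `φ(S x)`, where `x` is the variable `0` of `φ`. -/
def succInst (φ : Fml) : Fml := φ.subst (scons (succT (v 0)) (fun n => v (n + 1)))

/-- A universal closure of a formula. -/
def closure (φ : Fml) : Fml := all^[φ.fv.sup Nat.succ] φ

/-- The formula `∃ y < x, φ(y)`, where `y` is the variable `0` of `φ` and `x` is the variable with
index `x` outside of the quantifier. -/
def bex (x : ℕ) (φ : Fml) : Fml := ex (and (lt (v 0) (v (x + 1))) φ)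

/-- The formula `∀ y < x, φ(y)`, where `y` is the variable `0` of `φ` and `x` is the variable with
index `x` outside of the quantifier. -/
def ball (x : ℕ) (φ : Fml) : Fml := all (imp (lt (v 0) (v (x + 1))) φ)

/-- Quantifier-free formulas. -/
def IsQF : Fml → Prop
  | bot => True
  | eq _ _ => True
  | and φ ψ => IsQF φ ∧ IsQF ψ
  | or φ ψ => IsQF φ ∧ IsQF ψ
  | imp φ ψ => IsQF φ ∧ IsQF ψ
  | all _ => False
  | ex _ => False

end Fml

mutual

/-- The class `Σ_k` of formulas. -/
def SigmaF : ℕ → Set Fml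
  | 0 => {φ | φ.IsQF}
  | k + 1 => {χ | ∃ (n : ℕ) (φ : Fml), 1 ≤ n ∧ φ ∈ PiF k ∧ χ = Fml.ex^[n] φ}

/-- The class `Π_k` of formulas. -/
def PiF : ℕ → Set Fml
  | 0 => {φ | φ.IsQF}
  | k + 1 => {χ | ∃ (n : ℕ) (φ : Fml), 1 ≤ n ∧ φ ∈ SigmaF k ∧ χ = Fml.all^[n] φ}

end

/-- The class `Σ_m` for an integer `m`; it is empty for negative `m`. -/
def SigmaZ : ℤ → Set Fml
  | Int.ofNat k => SigmaF k
  | Int.negSucc _ => ∅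

/-- Intuitionistic natural deduction with equality: `Derives T Γ φ` means that `φ` is derivable from
the axioms in the set `T` of sentences and the open assumptions in `Γ`. -/
inductive Derives (T : Set Fml) : List Fml → Fml → Prop
  | ax {Γ : List Fml} {φ : Fml} : φ ∈ T → Derives T Γ φ
  | hyp {Γ : List Fml} {φ : Fml} : φ ∈ Γ → Derives T Γ φ
  | botE {Γ : List Fml} {φ : Fml} : Derives T Γ Fml.bot → Derives T Γ φ
  | andI {Γ : List Fml} {φ ψ : Fml} :
      Derives T Γ φ → Derives T Γ ψ → Derives T Γ (Fml.and φ ψ)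
  | andE₁ {Γ : List Fml} {φ ψ : Fml} : Derives T Γ (Fml.and φ ψ) → Derives T Γ φ
  | andE₂ {Γ : List Fml} {φ ψ : Fml} : Derives T Γ (Fml.and φ ψ) → Derives T Γ ψ
  | orI₁ {Γ : List Fml} {φ ψ : Fml} : Derives T Γ φ → Derives T Γ (Fml.or φ ψ)
  | orI₂ {Γ : List Fml} {φ ψ : Fml} : Derives T Γ ψ → Derives T Γ (Fml.or φ ψ)
  | orE {Γ : List Fml} {φ ψ χ : Fml} : Derives T Γ (Fml.or φ ψ) →
      Derives T (φ :: Γ) χ → Derives T (ψ :: Γ) χ → Derives T Γ χ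
  | impI {Γ : List Fml} {φ ψ : Fml} : Derives T (φ :: Γ) ψ → Derives T Γ (Fml.imp φ ψ)
  | impE {Γ : List Fml} {φ ψ : Fml} :
      Derives T Γ (Fml.imp φ ψ) → Derives T Γ φ → Derives T Γ ψ
  | allI {Γ : List Fml} {φ : Fml} :
      Derives T (Γ.map Fml.shift) φ → Derives T Γ (Fml.all φ)
  | allE {Γ : List Fml} {φ : Fml} (t : Tm) :
      Derives T Γ (Fml.all φ) → Derives T Γ (φ.inst t)
  | exI {Γ : List Fml} {φ : Fml} (t : Tm) :
      Derives T Γ (φ.inst t) → Derives T Γ (Fml.ex φ)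
  | exE {Γ : List Fml} {φ ψ : Fml} : Derives T Γ (Fml.ex φ) →
      Derives T (φ :: Γ.map Fml.shift) ψ.shift → Derives T Γ ψ
  | eqRefl {Γ : List Fml} (t : Tm) : Derives T Γ (Fml.eq t t)
  | eqSubst {Γ : List Fml} (φ : Fml) {s t : Tm} :
      Derives T Γ (Fml.eq s t) → Derives T Γ (φ.inst s) → Derives T Γ (φ.inst t)

/-- The theory `T` proves the formula `φ`. -/
def Proves (T : Set Fml) (φ : Fml) : Prop := Derives T [] φ

/-- Instances of the non-logical axioms of Heyting arithmetic: the axioms on the successor, the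
defining equations of the primitive recursive functions, and induction. -/
inductive HAInstance : Fml → Prop
  | succ_ne_zero (t : Tm) : HAInstance (Fml.neg (Fml.eq (succT t) zeroT))
  | succ_inj (s t : Tm) : HAInstance (Fml.imp (Fml.eq (succT s) (succT t)) (Fml.eq s t))
  | proj {n : ℕ} (i : Fin n) (ts : Fin n → Tm) :
      HAInstance (Fml.eq (app (PRSymbol.proj i) ts) (ts i))
  | comp {m n : ℕ} (f : PRSymbol m) (g : Fin m → PRSymbol n) (ts : Fin n → Tm) :
      HAInstance (Fml.eq (app (PRSymbol.comp f g) ts) (app f (fun j => app (g j) ts)))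
  | prec_zero {n : ℕ} (f : PRSymbol n) (g : PRSymbol (n + 2)) (ts : Fin n → Tm) :
      HAInstance (Fml.eq (app (PRSymbol.prec f g) (Fin.cons zeroT ts)) (app f ts))
  | prec_succ {n : ℕ} (f : PRSymbol n) (g : PRSymbol (n + 2)) (s : Tm) (ts : Fin n → Tm) :
      HAInstance (Fml.eq (app (PRSymbol.prec f g) (Fin.cons (succT s) ts))
        (app g (Fin.cons s (Fin.cons (app (PRSymbol.prec f g) (Fin.cons s ts)) ts))))
  | ind (φ : Fml) : HAInstance (Fml.imp (Fml.and (φ.inst zeroT)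
      (Fml.all (Fml.imp φ φ.succInst))) (Fml.all φ))

/-- Heyting arithmetic. -/
def HA : Set Fml := Fml.closure '' {φ | HAInstance φ}

/-- The theory `T + P`: the universal closures of all instances of `P` are added to `T`. -/
def plus (T P : Set Fml) : Set Fml := T ∪ Fml.closure '' P

/-- Instances of de Morgan's law `DML_Γ`. -/
def DML (Γ : Set Fml) : Set Fml :=
  {χ | ∃ φ ∈ Γ, ∃ ψ ∈ Γ, χ = Fml.imp (Fml.neg (Fml.and φ ψ)) (Fml.or (Fml.neg φ) (Fml.neg ψ))}

/-- Instances of the double negation elimination `DNE_Γ`. -/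
def DNE (Γ : Set Fml) : Set Fml :=
  {χ | ∃ φ ∈ Γ, χ = Fml.imp (Fml.neg (Fml.neg φ)) φ}

end HeytingArithmetic

-- Bounded universal quantification needs no classical principle: `exists_ball` shows in HA alone
-- that every Σ_k and every Π_k is closed under it. For quantifier-free φ, a characteristic term is
-- multiplied out by primitive recursion (`exists_isQF_ball`). For Π_{k+1}, the bounded quantifier
-- joins the leading universal block and the decidable guard y < x is pushed inwards
-- (`Derives.guard_iff`). For Σ_{k+1}, finite choice turns ∀y<x ∃z φ into ∃w ∀y<x φ(y, w_y) with w
-- coding a list (`Derives.ball_ex`); this is repeated for each leading ∃, and the inner Π_k formula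
-- is handled by induction. The second claim follows by weakening.
--
-- For the first claim, let φ^⊥ be the prenex classical negation (`Fml.dual`), which exchanges Π_k
-- and Σ_k. DNE below level k gives φ ↔ ¬φ^⊥ for φ in Π_k and ¬θ ↔ θ^⊥ for θ in Σ_k
-- (`Derives.neg_dual`, `Derives.dual_of_neg_of_dne`). With θ in Σ_k equivalent to ∀y<x φ^⊥, ∃y<x φ
-- ↔ ∃y<x ¬φ^⊥ ↔ ¬∀y<x φ^⊥ ↔ ¬θ ↔ θ^⊥, and θ^⊥ is Π_k. The second equivalence is where De Morgan's
-- law enters (`Derives.bex_neg_of_neg_ball`): by induction on x, a failure below x+1 is split into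
-- a failure below x or at x.

namespace HeytingArithmetic

open FirstOrder.Language (Term)

/-! ### Substitution calculus -/

/-- Composition of substitutions: first `σ`, then `τ`. -/
def compS (σ τ : ℕ → Tm) : ℕ → Tm := fun n => (σ n).subst τ

/-- The substitution that renames every variable `n` to `n + k`. -/
def sh (k : ℕ) : ℕ → Tm := fun n => v (n + k)

@[simp] theorem app_subst {n : ℕ} (f : PRSymbol n) (ts : Fin n → Tm) (σ : ℕ → Tm) :
    (app f ts).subst σ = app f (fun i => (ts i).subst σ) := rfl

@[simp] theorem v_subst (n : ℕ) (σ : ℕ → Tm) : (v n).subst σ = σ n := rfl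

@[simp] theorem zeroT_subst (σ : ℕ → Tm) : zeroT.subst σ = zeroT := by
  simp only [zeroT, app_subst]
  congr 1
  exact funext fun i => i.elim0

@[simp] theorem succT_subst (t : Tm) (σ : ℕ → Tm) : (succT t).subst σ = succT (t.subst σ) := rfl

theorem tm_subst_subst (t : Tm) (σ τ : ℕ → Tm) :
    (t.subst σ).subst τ = t.subst (compS σ τ) := by
  induction t with
  | var n => rfl
  | func f ts ih => simp only [Term.subst, ih]

theorem tm_subst_congr (t : Tm) {σ τ : ℕ → Tm} (h : ∀ n ∈ t.varFinset, σ n = τ n) :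
    t.subst σ = t.subst τ := by
  induction t with
  | var n => exact h n (by simp [Term.varFinset])
  | func f ts ih =>
    simp only [Term.subst]
    congr 1
    funext i
    refine ih i fun n hn => h n ?_
    simp only [Term.varFinset, Finset.mem_biUnion, Finset.mem_univ, true_and]
    exact ⟨i, hn⟩

@[simp] theorem tm_subst_v (t : Tm) : t.subst v = t := by
  induction t with
  | var n => rfl
  | func f ts ih => simp only [Term.subst, ih]

theorem relabel_eq_subst (t : Tm) (f : ℕ → ℕ) : t.relabel f = t.subst (fun n => v (f n)) := by
  induction t with
  | var n => rfl
  | func g ts ih => simp only [Term.relabel, Term.subst, ih]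

@[simp] theorem scons_zero (t : Tm) (σ : ℕ → Tm) : scons t σ 0 = t := rfl

@[simp] theorem scons_succ (t : Tm) (σ : ℕ → Tm) (n : ℕ) : scons t σ (n + 1) = σ n := rfl

@[simp] theorem sh_apply (k n : ℕ) : sh k n = v (n + k) := rfl

@[simp] theorem compS_apply (σ τ : ℕ → Tm) (n : ℕ) : compS σ τ n = (σ n).subst τ := rfl

/-- Unfolding `up` leaves only `scons`, `compS` and `sh`, whose equations form a normalising simp
set; de Bruijn bookkeeping is thereby left to `simp`. -/
theorem up_eq (σ : ℕ → Tm) : up σ = scons (v 0) (compS σ (sh 1)) := by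
  funext n
  cases n with
  | zero => rfl
  | succ n => exact relabel_eq_subst _ _

@[simp] theorem compS_scons (t : Tm) (σ τ : ℕ → Tm) :
    compS (scons t σ) τ = scons (t.subst τ) (compS σ τ) := by
  funext n
  cases n <;> rfl

@[simp] theorem v_compS (τ : ℕ → Tm) : compS v τ = τ := rfl

@[simp] theorem compS_v (σ : ℕ → Tm) : compS σ v = σ := by
  funext n
  exact tm_subst_v _

@[simp] theorem compS_assoc (σ τ ρ : ℕ → Tm) :
    compS (compS σ τ) ρ = compS σ (compS τ ρ) := by
  funext n
  exact tm_subst_subst _ _ _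

@[simp] theorem sh_zero : sh 0 = v := rfl

@[simp] theorem sh_compS_scons (k : ℕ) (t : Tm) (σ : ℕ → Tm) :
    compS (sh (k + 1)) (scons t σ) = compS (sh k) σ := rfl

@[simp] theorem sh_compS_sh (k m : ℕ) : compS (sh k) (sh m) = sh (k + m) := by
  funext n
  simp [Nat.add_assoc]

-- The eta law of the calculus: for k = 0 it makes instantiating a shifted body at `v 0` give the
-- body back.
@[simp] theorem scons_v_sh (k : ℕ) : scons (v k) (sh (k + 1)) = sh k := by
  funext n
  cases n with
  | zero => simp
  | succ n => simp only [scons_succ, sh_apply]; congr 1; omega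

attribute [simp] tm_subst_subst up_eq

theorem up_congr_of {s : Finset ℕ} {σ τ : ℕ → Tm}
    (h : ∀ n ∈ (s.erase 0).image Nat.pred, σ n = τ n) : ∀ n ∈ s, up σ n = up τ n := by
  intro n hn
  cases n with
  | zero => rfl
  | succ n =>
    have : σ n = τ n := h n (Finset.mem_image.2 ⟨n + 1, by simp [hn], rfl⟩)
    simp [up_eq, this]

namespace Fml

theorem subst_congr (φ : Fml) {σ τ : ℕ → Tm} (h : ∀ n ∈ φ.fv, σ n = τ n) :
    φ.subst σ = φ.subst τ := by
  induction φ generalizing σ τ with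
  | bot => rfl
  | eq s t =>
    simp only [subst]
    rw [tm_subst_congr s fun n hn => h n (Finset.mem_union_left _ hn),
      tm_subst_congr t fun n hn => h n (Finset.mem_union_right _ hn)]
  | and φ ψ ih₁ ih₂ | or φ ψ ih₁ ih₂ | imp φ ψ ih₁ ih₂ =>
    simp only [subst]
    rw [ih₁ fun n hn => h n (Finset.mem_union_left _ hn),
      ih₂ fun n hn => h n (Finset.mem_union_right _ hn)]
  | all φ ih | ex φ ih =>
    simp only [subst]
    rw [ih (up_congr_of h)]

@[simp] theorem subst_v (φ : Fml) : φ.subst v = φ := by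
  induction φ <;> simp_all [subst, up_eq]

@[simp] theorem subst_subst (φ : Fml) (σ τ : ℕ → Tm) :
    (φ.subst σ).subst τ = φ.subst (compS σ τ) := by
  induction φ generalizing σ τ <;> simp_all [subst, up_eq]

@[simp] theorem bot_subst (σ : ℕ → Tm) : bot.subst σ = bot := rfl
@[simp] theorem eq_subst (s t : Tm) (σ : ℕ → Tm) :
    (eq s t).subst σ = eq (s.subst σ) (t.subst σ) := rfl
@[simp] theorem and_subst (φ ψ : Fml) (σ : ℕ → Tm) :
    (and φ ψ).subst σ = and (φ.subst σ) (ψ.subst σ) := rfl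
@[simp] theorem or_subst (φ ψ : Fml) (σ : ℕ → Tm) :
    (or φ ψ).subst σ = or (φ.subst σ) (ψ.subst σ) := rfl
@[simp] theorem imp_subst (φ ψ : Fml) (σ : ℕ → Tm) :
    (imp φ ψ).subst σ = imp (φ.subst σ) (ψ.subst σ) := rfl
@[simp] theorem neg_subst (φ : Fml) (σ : ℕ → Tm) : (neg φ).subst σ = neg (φ.subst σ) := rfl
@[simp] theorem iff_subst (φ ψ : Fml) (σ : ℕ → Tm) :
    (iff φ ψ).subst σ = iff (φ.subst σ) (ψ.subst σ) := rfl
@[simp] theorem all_subst (φ : Fml) (σ : ℕ → Tm) :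
    (all φ).subst σ = all (φ.subst (scons (v 0) (compS σ (sh 1)))) := by
  rw [← up_eq]; rfl
@[simp] theorem ex_subst (φ : Fml) (σ : ℕ → Tm) :
    (ex φ).subst σ = ex (φ.subst (scons (v 0) (compS σ (sh 1)))) := by
  rw [← up_eq]; rfl
@[simp] theorem lt_subst (s t : Tm) (σ : ℕ → Tm) :
    (lt s t).subst σ = lt (s.subst σ) (t.subst σ) := by
  simp only [lt, eq_subst, app_subst, zeroT_subst]
  congr 2
  funext i
  fin_cases i <;> rfl

@[simp] theorem shift_eq (φ : Fml) : φ.shift = φ.subst (sh 1) := rfl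
@[simp] theorem inst_eq (φ : Fml) (t : Tm) : φ.inst t = φ.subst (scons t v) := rfl
@[simp] theorem succInst_eq (φ : Fml) :
    φ.succInst = φ.subst (scons (succT (v 0)) (sh 1)) := rfl

end Fml

/-! ### Structural rules of the calculus -/

namespace Derives

variable {T : Set Fml} {Γ : List Fml} {φ ψ χ : Fml}

theorem mono {T' : Set Fml} {Γ' : List Fml} (h : Derives T Γ φ) (hT : T ⊆ T') (hΓ : Γ ⊆ Γ') :
    Derives T' Γ' φ := by
  induction h generalizing Γ' with
  | ax h => exact ax (hT h)
  | hyp h => exact hyp (hΓ h)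
  | botE _ ih => exact botE (ih hΓ)
  | andI _ _ ih₁ ih₂ => exact andI (ih₁ hΓ) (ih₂ hΓ)
  | andE₁ _ ih => exact andE₁ (ih hΓ)
  | andE₂ _ ih => exact andE₂ (ih hΓ)
  | orI₁ _ ih => exact orI₁ (ih hΓ)
  | orI₂ _ ih => exact orI₂ (ih hΓ)
  | orE _ _ _ ih ih₁ ih₂ =>
    exact orE (ih hΓ) (ih₁ (List.cons_subset_cons _ hΓ)) (ih₂ (List.cons_subset_cons _ hΓ))
  | impI _ ih => exact impI (ih (List.cons_subset_cons _ hΓ))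
  | impE _ _ ih₁ ih₂ => exact impE (ih₁ hΓ) (ih₂ hΓ)
  | allI _ ih => exact allI (ih (List.map_subset _ hΓ))
  | allE t _ ih => exact allE t (ih hΓ)
  | exI t _ ih => exact exI t (ih hΓ)
  | exE _ _ ih₁ ih₂ =>
    exact exE (ih₁ hΓ) (ih₂ (List.cons_subset_cons _ (List.map_subset _ hΓ)))
  | eqRefl t => exact eqRefl t
  | eqSubst φ _ _ ih₁ ih₂ => exact eqSubst φ (ih₁ hΓ) (ih₂ hΓ)

theorem weaken {Γ' : List Fml} (h : Derives T Γ φ) (hΓ : Γ ⊆ Γ') : Derives T Γ' φ :=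
  h.mono subset_rfl hΓ

theorem wk (h : Derives T Γ φ) : Derives T (ψ :: Γ) φ :=
  h.weaken (List.subset_cons_self _ _)

theorem ofNil (h : Derives T [] φ) : Derives T Γ φ := h.weaken (List.nil_subset _)

theorem cut (h : Derives T Γ φ) (h' : Derives T (φ :: Γ) ψ) : Derives T Γ ψ := impE (impI h') h

theorem h0 : Derives T (φ :: Γ) φ := hyp (by simp)
theorem h1 : Derives T (ψ :: φ :: Γ) φ := hyp (by simp)
theorem h2 : Derives T (χ :: ψ :: φ :: Γ) φ := hyp (by simp)
theorem h3 {χ' : Fml} : Derives T (χ' :: χ :: ψ :: φ :: Γ) φ := hyp (by simp)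

/-- Quantifiers are removed from the outside, and the outermost of n + 1 binds index n of the
matrix. The general τ records the values already chosen, which is what the induction needs. -/
theorem iterate_all_elim (n : ℕ) {τ : ℕ → Tm} (h : Derives T Γ ((Fml.all^[n] φ).subst τ))
    {σ : ℕ → Tm} (hσ : ∀ i, σ (n + i) = τ i) : Derives T Γ (φ.subst σ) := by
  induction n generalizing τ with
  | zero =>
    have : σ = τ := funext fun i => by simpa using hσ i
    simpa [this] using h
  | succ n ih =>
    rw [Function.iterate_succ_apply'] at h
    have := allE (σ n) h
    simp only [Fml.inst_eq, Fml.subst_subst, up_eq, compS_scons, v_subst, scons_zero,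
      compS_assoc, sh_compS_scons, sh_zero, compS_v] at this
    refine ih this fun i => ?_
    cases i with
    | zero => rfl
    | succ i => rw [scons_succ, ← hσ i]; congr 1; omega

theorem iterate_all_intro (n : ℕ) (h : Derives T [] φ) : Derives T [] (Fml.all^[n] φ) := by
  induction n with
  | zero => exact h
  | succ n ih => rw [Function.iterate_succ_apply']; exact allI ih

theorem of_closure (h : Derives T Γ φ.closure) (σ : ℕ → Tm) : Derives T Γ (φ.subst σ) := by
  set n := φ.fv.sup Nat.succ with hn
  -- The closure binds only indices below n, so elimination forces i ≥ n to go to `v (i - n)`. No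
  -- free variable of φ is that large, so this agrees with σ on φ.
  rw [φ.subst_congr (τ := fun i => if i < n then σ i else v (i - n))]
  · refine iterate_all_elim n (τ := v) (by simpa [Fml.closure] using h) fun i => ?_
    simp
  · intro i hi
    have : i < n := Finset.le_sup (f := Nat.succ) hi
    simp [this]

/-- Closing and re-instantiating gives substitution into theorems without an induction on
derivations. -/
theorem subst_nil (h : Derives T [] φ) (σ : ℕ → Tm) : Derives T Γ (φ.subst σ) :=
  of_closure (ofNil (iterate_all_intro _ h)) σ

theorem instance_of_closure_mem (h : φ.closure ∈ T) : Derives T Γ φ := by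
  simpa using of_closure (Γ := Γ) (ax h) v

/-! ### Derived rules -/

theorem botE' (h : Derives T Γ (Fml.neg φ)) (h' : Derives T Γ φ) : Derives T Γ ψ :=
  botE (impE h h')

theorem negI (h : Derives T (φ :: Γ) Fml.bot) : Derives T Γ (Fml.neg φ) := impI h

theorem negE (h : Derives T Γ (Fml.neg φ)) (h' : Derives T Γ φ) : Derives T Γ Fml.bot :=
  impE h h'

theorem iffI (h : Derives T (φ :: Γ) ψ) (h' : Derives T (ψ :: Γ) φ) :
    Derives T Γ (Fml.iff φ ψ) := andI (impI h) (impI h')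

theorem mp (h : Derives T Γ (Fml.iff φ ψ)) (h' : Derives T Γ φ) : Derives T Γ ψ :=
  impE (andE₁ h) h'

theorem mpr (h : Derives T Γ (Fml.iff φ ψ)) (h' : Derives T Γ ψ) : Derives T Γ φ :=
  impE (andE₂ h) h'

theorem iffRefl : Derives T Γ (Fml.iff φ φ) := iffI h0 h0

theorem iffSymm (h : Derives T Γ (Fml.iff φ ψ)) : Derives T Γ (Fml.iff ψ φ) :=
  andI (andE₂ h) (andE₁ h)

theorem iffTrans (h : Derives T Γ (Fml.iff φ ψ)) (h' : Derives T Γ (Fml.iff ψ χ)) :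
    Derives T Γ (Fml.iff φ χ) := iffI (h'.wk.mp (h.wk.mp h0)) (h.wk.mpr (h'.wk.mpr h0))

/-- Elimination of a universal quantifier under a substitution. -/
theorem allE' (t : Tm) {σ : ℕ → Tm} (h : Derives T Γ ((Fml.all φ).subst σ)) :
    Derives T Γ (φ.subst (scons t σ)) := by
  simpa using allE t h

theorem allE_eq (t : Tm) (h : Derives T Γ (Fml.all φ)) (e : φ.subst (scons t v) = ψ) :
    Derives T Γ ψ := e ▸ allE t h

theorem exI_eq (t : Tm) (h : Derives T Γ ψ) (e : φ.subst (scons t v) = ψ) :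
    Derives T Γ (Fml.ex φ) := exI t (by rw [Fml.inst_eq, e]; exact h)

theorem all_congr (h : Derives T [] (Fml.iff φ ψ)) :
    Derives T Γ (Fml.iff (Fml.all φ) (Fml.all ψ)) := by
  refine ofNil (iffI (allI ?_) (allI ?_))
  · simp
    exact h.ofNil.mp (allE_eq (v 0) h0 (by simp))
  · simp
    exact h.ofNil.mpr (allE_eq (v 0) h0 (by simp))

theorem ex_mono (h : Derives T [] (Fml.imp φ ψ)) :
    Derives T Γ (Fml.imp (Fml.ex φ) (Fml.ex ψ)) := by
  refine ofNil (impI (exE h0 ?_))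
  simp only [Fml.shift_eq, Fml.ex_subst]
  refine exI (v 0) ?_
  simpa using h.ofNil.impE h0

theorem ex_congr (h : Derives T [] (Fml.iff φ ψ)) :
    Derives T Γ (Fml.iff (Fml.ex φ) (Fml.ex ψ)) :=
  andI (ex_mono (andE₁ h)) (ex_mono (andE₂ h))

theorem imp_congr {φ' ψ' : Fml} (h : Derives T Γ (Fml.iff φ φ')) (h' : Derives T Γ (Fml.iff ψ ψ')) :
    Derives T Γ (Fml.iff (Fml.imp φ ψ) (Fml.imp φ' ψ')) :=
  iffI (impI (h'.wk.wk.mp (impE h1 (h.wk.wk.mpr h0)))) (impI (h'.wk.wk.mpr (impE h1 (h.wk.wk.mp h0))))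

theorem and_congr {φ' ψ' : Fml} (h : Derives T Γ (Fml.iff φ φ')) (h' : Derives T Γ (Fml.iff ψ ψ')) :
    Derives T Γ (Fml.iff (Fml.and φ ψ) (Fml.and φ' ψ')) :=
  iffI (andI (h.wk.mp (andE₁ h0)) (h'.wk.mp (andE₂ h0)))
    (andI (h.wk.mpr (andE₁ h0)) (h'.wk.mpr (andE₂ h0)))

theorem or_congr {φ' ψ' : Fml} (h : Derives T Γ (Fml.iff φ φ')) (h' : Derives T Γ (Fml.iff ψ ψ')) :
    Derives T Γ (Fml.iff (Fml.or φ ψ) (Fml.or φ' ψ')) :=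
  iffI (orE h0 (orI₁ (h.wk.wk.mp h0)) (orI₂ (h'.wk.wk.mp h0)))
    (orE h0 (orI₁ (h.wk.wk.mpr h0)) (orI₂ (h'.wk.wk.mpr h0)))

theorem neg_congr (h : Derives T Γ (Fml.iff φ ψ)) :
    Derives T Γ (Fml.iff (Fml.neg φ) (Fml.neg ψ)) := imp_congr h iffRefl

/-! ### Equality -/

variable {s t u : Tm}

theorem eqSymm (h : Derives T Γ (Fml.eq s t)) : Derives T Γ (Fml.eq t s) := by
  have := eqSubst (Fml.eq (v 0) (s.subst (sh 1))) h (by simpa using eqRefl s)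
  simpa using this

theorem eqTrans (h : Derives T Γ (Fml.eq s t)) (h' : Derives T Γ (Fml.eq t u)) :
    Derives T Γ (Fml.eq s u) := by
  have := eqSubst (Fml.eq (s.subst (sh 1)) (v 0)) h' (by simpa using h)
  simpa using this

/-- Replacement of equals in a formula under a substitution. -/
theorem replace {σ : ℕ → Tm} (h : Derives T Γ (Fml.eq s t))
    (h' : Derives T Γ (φ.subst (scons s σ))) : Derives T Γ (φ.subst (scons t σ)) := by
  have := eqSubst (φ.subst (scons (v 0) (compS σ (sh 1)))) h (by simpa using h')
  simpa using this

theorem replace_eq (φ : Fml) (h : Derives T Γ (Fml.eq s t)) (h' : Derives T Γ ψ)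
    (e : φ.subst (scons s v) = ψ) (e' : φ.subst (scons t v) = χ) : Derives T Γ χ := by
  subst e e'
  exact eqSubst φ h h'

theorem app_congr {n : ℕ} (f : PRSymbol n) {ss ts : Fin n → Tm}
    (h : ∀ i, Derives T Γ (Fml.eq (ss i) (ts i))) :
    Derives T Γ (Fml.eq (app f ss) (app f ts)) := by
  have key : ∀ k ≤ n, Derives T Γ (Fml.eq (app f ss)
      (app f (fun i => if (i : ℕ) < k then ts i else ss i))) := by
    intro k
    induction k with
    | zero => intro _; simpa using eqRefl _
    | succ k ih =>
      intro hk
      -- Arguments are exchanged one at a time: position k is the hole `v 0`, and all others are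
      -- shifted past it.
      let w : Fin n → Tm := fun i =>
        if (i : ℕ) = k then v 0 else if (i : ℕ) < k then (ts i).subst (sh 1) else (ss i).subst (sh 1)
      have := eqSubst (Fml.eq ((app f ss).subst (sh 1)) (app f w)) (h ⟨k, hk⟩) (by
        convert ih (by omega) using 1
        simp only [Fml.inst_eq, Fml.eq_subst, app_subst, tm_subst_subst, sh_compS_scons, sh_zero,
          v_compS, tm_subst_v]
        congr 2
        funext i
        by_cases h1 : (i : ℕ) = k
        · have : i = ⟨k, hk⟩ := Fin.ext h1
          subst this
          simp [w]
        · by_cases h2 : (i : ℕ) < k <;> simp [w, h1, h2])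
      convert this using 1
      simp only [Fml.inst_eq, Fml.eq_subst, app_subst, tm_subst_subst, sh_compS_scons, sh_zero,
          v_compS, tm_subst_v]
      congr 2
      funext i
      by_cases h1 : (i : ℕ) = k
      · have : i = ⟨k, hk⟩ := Fin.ext h1
        subst this
        simp [w]
      · by_cases h2 : (i : ℕ) < k
        · simp [w, h1, h2, Nat.lt_succ_of_lt h2]
        · have : ¬ (i : ℕ) < k + 1 := by omega
          simp [w, h1, h2, this]
  simpa using key n le_rfl

end Derives

/-- The theory `T` contains Heyting arithmetic. -/
class ExtendsHA (T : Set Fml) : Prop where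
  sub : HA ⊆ T

instance : ExtendsHA HA := ⟨subset_rfl⟩

/-! ### Primitive recursive functions given by terms -/

/-- The assignment of `ts` to the first `n` variables, and of `0` to the others. -/
def env {n : ℕ} (ts : Fin n → Tm) : ℕ → Tm := fun i => if h : i < n then ts ⟨i, h⟩ else zeroT

@[simp] theorem env_cons {n : ℕ} (t : Tm) (ts : Fin n → Tm) :
    env (Fin.cons t ts : Fin (n + 1) → Tm) = scons t (env ts) := by
  funext i
  cases i with
  | zero => rfl
  | succ i =>
    by_cases h : i < n
    · simp only [env, h, scons_succ, Nat.add_lt_add_iff_right, dite_true]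
      rfl
    · simp [env, h]

@[simp] theorem env_vecCons {n : ℕ} (t : Tm) (ts : Fin n → Tm) :
    env (Matrix.vecCons t ts) = scons t (env ts) := env_cons t ts

/-- The constant function `0`. -/
def zeroS (n : ℕ) : PRSymbol n := PRSymbol.comp PRSymbol.zero Fin.elim0

/-- A function symbol for the `n`-ary function defined by a term. -/
def symOf (n : ℕ) : Tm → PRSymbol n
  | Term.var i => if h : i < n then PRSymbol.proj ⟨i, h⟩ else zeroS n
  | @Term.func _ _ _ f ts => PRSymbol.comp (m := _) f fun j => symOf n (ts j)

/-- The function defined by primitive recursion from two terms. -/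
def recS (n : ℕ) (s t : Tm) : PRSymbol (n + 1) := PRSymbol.prec (symOf n s) (symOf (n + 2) t)

namespace Derives

variable {T : Set Fml} [hT : ExtendsHA T] {Γ : List Fml} {φ ψ χ : Fml}

theorem haInst (h : HAInstance φ) : Derives T Γ φ :=
  instance_of_closure_mem (hT.sub ⟨φ, h, rfl⟩)

theorem comp_eq {m n : ℕ} (f : PRSymbol m) (g : Fin m → PRSymbol n) (ts : Fin n → Tm)
    {us : Fin m → Tm} (h : ∀ j, Derives T Γ (Fml.eq (app (g j) ts) (us j))) :
    Derives T Γ (Fml.eq (app (PRSymbol.comp f g) ts) (app f us)) :=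
  (haInst (.comp f g ts)).eqTrans (app_congr f h)

theorem zeroS_eq {n : ℕ} (ts : Fin n → Tm) : Derives T Γ (Fml.eq (app (zeroS n) ts) zeroT) :=
  comp_eq _ _ _ fun j => j.elim0

theorem symOf_eq (n : ℕ) (t : Tm) (ts : Fin n → Tm) :
    Derives T Γ (Fml.eq (app (symOf n t) ts) (t.subst (env ts))) := by
  induction t with
  | var i =>
    by_cases h : i < n
    · simpa [symOf, h, Term.subst, env] using haInst (.proj _ _)
    · simpa [symOf, h, Term.subst, env] using zeroS_eq ts
  | func f us ih => exact comp_eq (T := T) (Γ := Γ) (m := _) f _ ts ih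

theorem recS_zero (n : ℕ) (s t : Tm) (ts : Fin n → Tm) :
    Derives T Γ (Fml.eq (app (recS n s t) (Fin.cons zeroT ts)) (s.subst (env ts))) :=
  (haInst (.prec_zero _ _ _)).eqTrans (symOf_eq _ _ _)

/-- In the step term, index 0 is the counter, index 1 the previous value, and the parameters start
at index 2. This fixes the indices in the functions defined below. -/
theorem recS_succ (n : ℕ) (s t : Tm) (r : Tm) (ts : Fin n → Tm) :
    Derives T Γ (Fml.eq (app (recS n s t) (Fin.cons (succT r) ts))
      (t.subst (scons r (scons (app (recS n s t) (Fin.cons r ts)) (env ts))))) := by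
  have := (haInst (T := T) (Γ := Γ) (.prec_succ _ _ r ts)).eqTrans
    (symOf_eq (n + 2) t (Fin.cons r (Fin.cons (app (recS n s t) (Fin.cons r ts)) ts)))
  rwa [env_cons, env_cons] at this

/-! ### Induction and case distinction -/

/-- The premises allow no side context, so side assumptions have to be antecedents inside φ; in
exchange σ instantiates the induction variable and all parameters at once. -/
theorem induct (h : Derives T [] (φ.subst (scons zeroT v)))
    (hs : Derives T [φ] (φ.subst (scons (succT (v 0)) (sh 1)))) (σ : ℕ → Tm) :
    Derives T Γ (φ.subst σ) := by
  have key : Derives T [] φ := by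
    simpa using allE (v 0) (subst_nil (Γ := []) (impE (haInst (.ind φ))
      (andI h (allI (impI hs)))) (sh 1))
  exact key.subst_nil σ

theorem induct_cases (h : Derives T [] (φ.subst (scons zeroT v)))
    (hs : Derives T [] (φ.subst (scons (succT (v 0)) (sh 1)))) (σ : ℕ → Tm) :
    Derives T Γ (φ.subst σ) := induct h hs.wk σ

end Derives

/-! ### Predecessor, subtraction and order -/

/-- Application of a unary function. -/
def app1 (f : PRSymbol 1) (t : Tm) : Tm := app f ![t]

/-- Application of a binary function. -/
def app2 (f : PRSymbol 2) (s t : Tm) : Tm := app f ![s, t]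

/-- Application of a ternary function. -/
def app3 (f : PRSymbol 3) (s t u : Tm) : Tm := app f ![s, t, u]

@[simp] theorem app1_subst (f : PRSymbol 1) (t : Tm) (σ : ℕ → Tm) :
    (app1 f t).subst σ = app1 f (t.subst σ) := by
  simp only [app1, app_subst]
  congr 1
  funext i
  fin_cases i; rfl

@[simp] theorem app2_subst (f : PRSymbol 2) (s t : Tm) (σ : ℕ → Tm) :
    (app2 f s t).subst σ = app2 f (s.subst σ) (t.subst σ) := by
  simp only [app2, app_subst]
  congr 1
  funext i
  fin_cases i <;> rfl

@[simp] theorem app3_subst (f : PRSymbol 3) (s t u : Tm) (σ : ℕ → Tm) :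
    (app3 f s t u).subst σ = app3 f (s.subst σ) (t.subst σ) (u.subst σ) := by
  simp only [app3, app_subst]
  congr 1
  funext i
  fin_cases i <;> rfl

/-- The predecessor of a term. -/
def predT (t : Tm) : Tm := app1 predS t

/-- Truncated subtraction. -/
def subT (s t : Tm) : Tm := app2 rsubS t s

@[simp] theorem predT_subst (t : Tm) (σ : ℕ → Tm) : (predT t).subst σ = predT (t.subst σ) :=
  app1_subst _ _ _

@[simp] theorem subT_subst (s t : Tm) (σ : ℕ → Tm) :
    (subT s t).subst σ = subT (s.subst σ) (t.subst σ) := app2_subst _ _ _ _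

theorem lt_eq (s t : Tm) : Fml.lt s t = Fml.eq (subT (succT s) t) zeroT := rfl

namespace Derives

variable {T : Set Fml} {Γ : List Fml} {φ ψ χ : Fml} {r s t u s' t' u' : Tm}

theorem succ_congr (h : Derives T Γ (Fml.eq s t)) : Derives T Γ (Fml.eq (succT s) (succT t)) :=
  app_congr _ fun _ => h

theorem app1_congr (f : PRSymbol 1) (h : Derives T Γ (Fml.eq s t)) :
    Derives T Γ (Fml.eq (app1 f s) (app1 f t)) :=
  app_congr _ fun i => by fin_cases i; exact h

theorem app2_congr (f : PRSymbol 2) (h : Derives T Γ (Fml.eq s s'))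
    (h' : Derives T Γ (Fml.eq t t')) : Derives T Γ (Fml.eq (app2 f s t) (app2 f s' t')) :=
  app_congr _ fun i => by
    fin_cases i
    · exact h
    · exact h'

theorem app3_congr (f : PRSymbol 3) (h : Derives T Γ (Fml.eq s s'))
    (h' : Derives T Γ (Fml.eq t t')) (h'' : Derives T Γ (Fml.eq u u')) :
    Derives T Γ (Fml.eq (app3 f s t u) (app3 f s' t' u')) :=
  app_congr _ fun i => by
    fin_cases i
    · exact h
    · exact h'
    · exact h''

theorem pred_congr (h : Derives T Γ (Fml.eq s t)) : Derives T Γ (Fml.eq (predT s) (predT t)) :=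
  app1_congr _ h

theorem sub_congr (h : Derives T Γ (Fml.eq s s')) (h' : Derives T Γ (Fml.eq t t')) :
    Derives T Γ (Fml.eq (subT s t) (subT s' t')) := app2_congr _ h' h

variable [hT : ExtendsHA T]

theorem succ_ne_zero (t : Tm) : Derives T Γ (Fml.neg (Fml.eq (succT t) zeroT)) :=
  haInst (.succ_ne_zero t)

theorem succ_absurd (h : Derives T Γ (Fml.eq t zeroT)) (h' : Derives T Γ (Fml.eq t (succT s))) :
    Derives T Γ φ := botE' (succ_ne_zero s) (h'.eqSymm.eqTrans h)

theorem pred_zero : Derives T Γ (Fml.eq (predT zeroT) zeroT) := by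
  have : Derives T Γ _ := haInst (.prec_zero PRSymbol.zero (PRSymbol.proj 0) ![])
  rwa [show app PRSymbol.zero ![] = zeroT from congrArg _ (funext fun i => i.elim0)] at this

theorem pred_succ (t : Tm) : Derives T Γ (Fml.eq (predT (succT t)) t) :=
  (haInst (.prec_succ PRSymbol.zero (PRSymbol.proj 0) t ![])).eqTrans (haInst (.proj _ _))

theorem sub_zero (s : Tm) : Derives T Γ (Fml.eq (subT s zeroT) s) :=
  (haInst (.prec_zero (PRSymbol.proj 0) (PRSymbol.comp predS (fun _ => PRSymbol.proj 1))
    ![s])).eqTrans (haInst (.proj _ _))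

theorem sub_succ (s t : Tm) : Derives T Γ (Fml.eq (subT s (succT t)) (predT (subT s t))) :=
  (haInst (.prec_succ (PRSymbol.proj 0) (PRSymbol.comp predS (fun _ => PRSymbol.proj 1)) t
    ![s])).eqTrans (comp_eq _ _ _ fun i => by fin_cases i; exact haInst (.proj _ _))

theorem zero_or_succ (t : Tm) :
    Derives T Γ (Fml.or (Fml.eq t zeroT) (Fml.eq t (succT (predT t)))) := by
  have := induct_cases (T := T) (Γ := Γ)
    (φ := Fml.or (Fml.eq (v 0) zeroT) (Fml.eq (v 0) (succT (predT (v 0)))))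
    (by simpa using orI₁ (eqRefl _)) (by simpa using orI₂ (succ_congr (pred_succ _).eqSymm))
    (scons t v)
  simpa using this

theorem zeroCases (t : Tm) (h : Derives T (Fml.eq t zeroT :: Γ) φ)
    (h' : Derives T (Fml.eq t (succT (predT t)) :: Γ) φ) : Derives T Γ φ :=
  orE (zero_or_succ t) h h'

theorem zero_sub (t : Tm) : Derives T Γ (Fml.eq (subT zeroT t) zeroT) := by
  have := induct (T := T) (Γ := Γ) (φ := Fml.eq (subT zeroT (v 0)) zeroT)
    (by simpa using sub_zero _)
    (by simpa using (sub_succ _ _).eqTrans ((pred_congr h0).eqTrans pred_zero)) (scons t v)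
  simpa using this

theorem succ_sub_succ (s t : Tm) :
    Derives T Γ (Fml.eq (subT (succT s) (succT t)) (subT s t)) := by
  have := induct (T := T) (Γ := Γ)
    (φ := Fml.eq (subT (succT (v 1)) (succT (v 0))) (subT (v 1) (v 0)))
    (by simpa using (sub_succ _ _).eqTrans ((pred_congr (sub_zero _)).eqTrans
      ((pred_succ _).eqTrans (sub_zero _).eqSymm)))
    (by simpa using (sub_succ _ _).eqTrans ((pred_congr h0).eqTrans (sub_succ _ _).eqSymm))
    (scons t (scons s v))
  simpa using this

theorem sub_self (t : Tm) : Derives T Γ (Fml.eq (subT t t) zeroT) := by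
  have := induct (T := T) (Γ := Γ) (φ := Fml.eq (subT (v 0) (v 0)) zeroT)
    (by simpa using sub_zero _) (by simpa using (succ_sub_succ _ _).eqTrans h0) (scons t v)
  simpa using this

theorem succ_sub_self (t : Tm) : Derives T Γ (Fml.eq (subT (succT t) t) (succT zeroT)) := by
  have := induct (T := T) (Γ := Γ) (φ := Fml.eq (subT (succT (v 0)) (v 0)) (succT zeroT))
    (by simpa using sub_zero _) (by simpa using (succ_sub_succ _ _).eqTrans h0) (scons t v)
  simpa using this

/-- Induction on s with t quantified inside the formula, since the step uses the hypothesis at the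
predecessor of t. The same device serves `lt_or_eq_of_sub_eq_zero`. -/
theorem sub_antisymm (h : Derives T Γ (Fml.eq (subT s t) zeroT))
    (h' : Derives T Γ (Fml.eq (subT t s) zeroT)) : Derives T Γ (Fml.eq s t) := by
  have := induct (T := T) (Γ := Γ)
    (φ := Fml.all (Fml.imp (Fml.eq (subT (v 1) (v 0)) zeroT)
      (Fml.imp (Fml.eq (subT (v 0) (v 1)) zeroT) (Fml.eq (v 1) (v 0)))))
    (by
      simp only [Fml.all_subst]
      refine allI (impI (impI ?_))
      simpa using h0.eqSymm.eqTrans (sub_zero _))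
    (by
      simp only [Fml.all_subst]
      refine allI (impI (impI ?_))
      simp
      refine zeroCases (v 0) ?_ ?_
      · exact succ_absurd ((sub_congr (eqRefl _) h0.eqSymm).eqTrans h2) (sub_zero _)
      · refine (succ_congr (impE (impE (allE_eq (predT (v 0)) h3 (by simp; exact ⟨rfl, rfl⟩)) ?_) ?_)).eqTrans
          h0.eqSymm
        · exact (succ_sub_succ _ _).eqSymm.eqTrans ((sub_congr (eqRefl _) h0.eqSymm).eqTrans h2)
        · exact (succ_sub_succ _ _).eqSymm.eqTrans ((sub_congr h0.eqSymm (eqRefl _)).eqTrans h1))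
    (scons s v)
  have := allE' t this
  exact impE (impE (by simpa using this) h) h'

theorem lt_or_eq_of_sub_eq_zero (h : Derives T Γ (Fml.eq (subT s t) zeroT)) :
    Derives T Γ (Fml.or (Fml.lt s t) (Fml.eq s t)) := by
  have := induct (T := T) (Γ := Γ)
    (φ := Fml.all (Fml.imp (Fml.eq (subT (v 1) (v 0)) zeroT)
      (Fml.or (Fml.lt (v 1) (v 0)) (Fml.eq (v 1) (v 0)))))
    (by
      simp only [Fml.all_subst]
      refine allI (impI ?_)
      simp
      refine zeroCases (v 0) (orI₂ h0.eqSymm) (orI₁ ?_)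
      exact (sub_congr (eqRefl _) h0).eqTrans ((succ_sub_succ _ _).eqTrans (zero_sub _)))
    (by
      simp only [Fml.all_subst]
      refine allI (impI ?_)
      simp
      refine zeroCases (v 0) ?_ ?_
      · exact succ_absurd ((sub_congr (eqRefl _) h0.eqSymm).eqTrans h1) (sub_zero _)
      · refine orE (impE (allE_eq (predT (v 0)) h2 (by simp; exact ⟨rfl, rfl, rfl⟩)) ?_) (orI₁ ?_) (orI₂ ?_)
        · exact (succ_sub_succ _ _).eqSymm.eqTrans ((sub_congr (eqRefl _) h0.eqSymm).eqTrans h1)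
        · exact (sub_congr (eqRefl _) h1).eqTrans ((succ_sub_succ _ _).eqTrans h0)
        · exact (succ_congr h0).eqTrans h1.eqSymm)
    (scons s v)
  have := allE' t this
  exact impE (by simpa using this) h

theorem sub_eq_zero_of_lt (h : Derives T Γ (Fml.lt s t)) :
    Derives T Γ (Fml.eq (subT s t) zeroT) :=
  zeroCases (subT s t) h0 (succ_absurd
    ((sub_succ (succT s) t).eqTrans ((pred_congr (wk h)).eqTrans pred_zero))
    ((succ_sub_succ _ _).eqTrans h0))

theorem not_lt_zero (h : Derives T Γ (Fml.lt s zeroT)) : Derives T Γ φ :=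
  succ_absurd h (sub_zero _)

theorem lt_succ_of_lt (h : Derives T Γ (Fml.lt s t)) : Derives T Γ (Fml.lt s (succT t)) :=
  (succ_sub_succ _ _).eqTrans (sub_eq_zero_of_lt h)

theorem lt_succ_of_eq (h : Derives T Γ (Fml.eq s t)) : Derives T Γ (Fml.lt s (succT t)) :=
  (succ_sub_succ _ _).eqTrans ((sub_congr h (eqRefl _)).eqTrans (sub_self _))

theorem lt_or_eq_of_lt_succ (h : Derives T Γ (Fml.lt s (succT t))) :
    Derives T Γ (Fml.or (Fml.lt s t) (Fml.eq s t)) :=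
  lt_or_eq_of_sub_eq_zero ((succ_sub_succ _ _).eqSymm.eqTrans h)

/-- This matches list positions when an entry is put in front. If t - s were 0, antisymmetry would
give t = s + 1 and hence t - s = 1. -/
theorem sub_eq_succ_of_lt (h : Derives T Γ (Fml.lt s t)) :
    Derives T Γ (Fml.eq (subT t s) (succT (subT t (succT s)))) := by
  refine zeroCases (subT t s) ?_ (h0.eqTrans (succ_congr (sub_succ _ _).eqSymm))
  have e : Derives T (Fml.eq (subT t s) zeroT :: Γ) (Fml.eq (succT s) t) :=
    sub_antisymm (wk h) ((sub_succ _ _).eqTrans ((pred_congr h0).eqTrans pred_zero))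
  exact succ_absurd h0 ((sub_congr e.eqSymm (eqRefl _)).eqTrans (succ_sub_self _))

end Derives

/-! ### Boolean operations and conditionals -/

/-- `0` if both arguments are `0`, and `1` otherwise. -/
def andT (s t : Tm) : Tm := app2 (recS 1 (v 0) (succT zeroT)) s t

/-- `0` if one of the arguments is `0`. -/
def orT (s t : Tm) : Tm := app2 (recS 1 zeroT (v 2)) s t

/-- `0` if the second argument is `0` or the first one is not. -/
def impT (s t : Tm) : Tm := app2 (recS 1 (v 0) zeroT) s t

/-- The second argument if the first one is `0`, and the third one otherwise. -/
def iteT (r s t : Tm) : Tm := app3 (recS 2 (v 0) (v 3)) r s t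

/-- `0` if and only if the arguments are equal. -/
def eqT (s t : Tm) : Tm := andT (subT s t) (subT t s)

@[simp] theorem andT_subst (s t : Tm) (σ : ℕ → Tm) :
    (andT s t).subst σ = andT (s.subst σ) (t.subst σ) := app2_subst _ _ _ _
@[simp] theorem iteT_subst (r s t : Tm) (σ : ℕ → Tm) :
    (iteT r s t).subst σ = iteT (r.subst σ) (s.subst σ) (t.subst σ) := app3_subst _ _ _ _ _
@[simp] theorem eqT_subst (s t : Tm) (σ : ℕ → Tm) :
    (eqT s t).subst σ = eqT (s.subst σ) (t.subst σ) := by simp [eqT]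

namespace Derives

variable {T : Set Fml} {Γ : List Fml} {φ ψ χ : Fml} {r s t u s' t' u' : Tm} [hT : ExtendsHA T]

theorem and_zero (h : Derives T Γ (Fml.eq s zeroT)) : Derives T Γ (Fml.eq (andT s t) t) :=
  (app2_congr _ h (eqRefl t)).eqTrans (by simpa [app2] using recS_zero 1 (v 0) (succT zeroT) ![t])

theorem and_succ (h : Derives T Γ (Fml.eq s (succT r))) :
    Derives T Γ (Fml.eq (andT s t) (succT zeroT)) :=
  (app2_congr _ h (eqRefl t)).eqTrans (by simpa [app2] using recS_succ 1 (v 0) (succT zeroT) r ![t])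

theorem or_zero (h : Derives T Γ (Fml.eq s zeroT)) : Derives T Γ (Fml.eq (orT s t) zeroT) :=
  (app2_congr _ h (eqRefl t)).eqTrans (by simpa [app2] using recS_zero 1 zeroT (v 2) ![t])

theorem or_succ (h : Derives T Γ (Fml.eq s (succT r))) : Derives T Γ (Fml.eq (orT s t) t) :=
  (app2_congr _ h (eqRefl t)).eqTrans (by simpa [app2] using recS_succ 1 zeroT (v 2) r ![t])

theorem imp_zero (h : Derives T Γ (Fml.eq s zeroT)) : Derives T Γ (Fml.eq (impT s t) t) :=
  (app2_congr _ h (eqRefl t)).eqTrans (by simpa [app2] using recS_zero 1 (v 0) zeroT ![t])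

theorem imp_succ (h : Derives T Γ (Fml.eq s (succT r))) : Derives T Γ (Fml.eq (impT s t) zeroT) :=
  (app2_congr _ h (eqRefl t)).eqTrans (by simpa [app2] using recS_succ 1 (v 0) zeroT r ![t])

theorem ite_zero (h : Derives T Γ (Fml.eq r zeroT)) : Derives T Γ (Fml.eq (iteT r s t) s) :=
  (app3_congr _ h (eqRefl s) (eqRefl t)).eqTrans (by simpa [app3] using recS_zero 2 (v 0) (v 3) ![s, t])

theorem ite_succ (h : Derives T Γ (Fml.eq r (succT u))) : Derives T Γ (Fml.eq (iteT r s t) t) :=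
  (app3_congr _ h (eqRefl s) (eqRefl t)).eqTrans (by simpa [app3] using recS_succ 2 (v 0) (v 3) u ![s, t])

theorem andT_iff : Derives T Γ (Fml.iff (Fml.and (Fml.eq s zeroT) (Fml.eq t zeroT))
    (Fml.eq (andT s t) zeroT)) := by
  refine iffI ((and_zero (andE₁ h0)).eqTrans (andE₂ h0)) (zeroCases s ?_ ?_)
  · exact andI h0 ((and_zero h0).eqSymm.eqTrans h1)
  · exact succ_absurd h1 (and_succ h0)

theorem orT_iff : Derives T Γ (Fml.iff (Fml.or (Fml.eq s zeroT) (Fml.eq t zeroT))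
    (Fml.eq (orT s t) zeroT)) := by
  refine iffI (zeroCases s (or_zero h0) ((or_succ h0).eqTrans ?_)) (zeroCases s (orI₁ h0) ?_)
  · exact orE h1 (succ_absurd h0 h1) h0
  · exact orI₂ ((or_succ h0).eqSymm.eqTrans h1)

theorem impT_iff : Derives T Γ (Fml.iff (Fml.imp (Fml.eq s zeroT) (Fml.eq t zeroT))
    (Fml.eq (impT s t) zeroT)) := by
  refine iffI (zeroCases s ((imp_zero h0).eqTrans (impE h1 h0)) (imp_succ h0)) (impI ?_)
  exact (imp_zero h0).eqSymm.eqTrans h1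

theorem eqT_iff : Derives T Γ (Fml.iff (Fml.eq s t) (Fml.eq (eqT s t) zeroT)) := by
  refine iffTrans (iffI (andI ?_ ?_) (sub_antisymm (andE₁ h0) (andE₂ h0))) andT_iff
  · exact (sub_congr h0 (eqRefl _)).eqTrans (sub_self _)
  · exact (sub_congr (eqRefl _) h0).eqTrans (sub_self _)

end Derives

/-! ### Addition, pairing and finite sequences -/

/-- Addition. -/
def addT (s t : Tm) : Tm := app2 (recS 1 (v 0) (succT (v 1))) s t

/-- The triangular number `0 + 1 + ... + t`. -/
def triT (t : Tm) : Tm := app1 (recS 0 zeroT (succT (addT (v 1) (v 0)))) t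

/-- The index of the diagonal that contains the pair with code `t`, that is, the sum of its
components. -/
def diagT (t : Tm) : Tm :=
  app1 (recS 0 zeroT (iteT (eqT (v 0) (addT (triT (v 1)) (v 1))) (succT (v 1)) (v 1))) t

/-- Cantor's code of a pair. -/
def pairT (s t : Tm) : Tm := addT (triT (addT s t)) s

/-- The first component of a code of a pair. -/
def fstT (t : Tm) : Tm := subT t (triT (diagT t))

/-- The second component of a code of a pair. -/
def sndT (t : Tm) : Tm := subT (diagT t) (fstT t)

/-- The iterate `sndT^[i] w`. -/
def dropT (i w : Tm) : Tm := app2 (recS 1 (v 0) (sndT (v 1))) i w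

/-- The entry with index `i` of the list with code `w`. -/
def entryT (w i : Tm) : Tm := fstT (dropT i w)

@[simp] theorem addT_subst (s t : Tm) (σ : ℕ → Tm) :
    (addT s t).subst σ = addT (s.subst σ) (t.subst σ) := app2_subst _ _ _ _
@[simp] theorem triT_subst (t : Tm) (σ : ℕ → Tm) : (triT t).subst σ = triT (t.subst σ) :=
  app1_subst _ _ _
@[simp] theorem diagT_subst (t : Tm) (σ : ℕ → Tm) : (diagT t).subst σ = diagT (t.subst σ) :=
  app1_subst _ _ _
@[simp] theorem pairT_subst (s t : Tm) (σ : ℕ → Tm) :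
    (pairT s t).subst σ = pairT (s.subst σ) (t.subst σ) := by simp [pairT]
@[simp] theorem fstT_subst (t : Tm) (σ : ℕ → Tm) : (fstT t).subst σ = fstT (t.subst σ) := by
  simp [fstT]
@[simp] theorem sndT_subst (t : Tm) (σ : ℕ → Tm) : (sndT t).subst σ = sndT (t.subst σ) := by
  simp [sndT]
@[simp] theorem dropT_subst (s t : Tm) (σ : ℕ → Tm) :
    (dropT s t).subst σ = dropT (s.subst σ) (t.subst σ) := app2_subst _ _ _ _
@[simp] theorem entryT_subst (s t : Tm) (σ : ℕ → Tm) :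
    (entryT s t).subst σ = entryT (s.subst σ) (t.subst σ) := by simp [entryT]

namespace Derives

variable {T : Set Fml} {Γ : List Fml} {φ ψ χ : Fml} {r s t u s' t' u' : Tm}

theorem add_congr (h : Derives T Γ (Fml.eq s s')) (h' : Derives T Γ (Fml.eq t t')) :
    Derives T Γ (Fml.eq (addT s t) (addT s' t')) := app2_congr _ h h'

theorem tri_congr (h : Derives T Γ (Fml.eq s t)) : Derives T Γ (Fml.eq (triT s) (triT t)) :=
  app1_congr _ h

theorem diag_congr (h : Derives T Γ (Fml.eq s t)) : Derives T Γ (Fml.eq (diagT s) (diagT t)) :=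
  app1_congr _ h

theorem fst_congr (h : Derives T Γ (Fml.eq s t)) : Derives T Γ (Fml.eq (fstT s) (fstT t)) :=
  sub_congr h (tri_congr (diag_congr h))

theorem snd_congr (h : Derives T Γ (Fml.eq s t)) : Derives T Γ (Fml.eq (sndT s) (sndT t)) :=
  sub_congr (diag_congr h) (fst_congr h)

theorem drop_congr (h : Derives T Γ (Fml.eq s s')) (h' : Derives T Γ (Fml.eq t t')) :
    Derives T Γ (Fml.eq (dropT s t) (dropT s' t')) := app2_congr _ h h'

theorem entry_congr (h : Derives T Γ (Fml.eq s s')) (h' : Derives T Γ (Fml.eq t t')) :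
    Derives T Γ (Fml.eq (entryT s t) (entryT s' t')) := fst_congr (drop_congr h' h)

variable [hT : ExtendsHA T]

theorem zero_add (t : Tm) : Derives T Γ (Fml.eq (addT zeroT t) t) := by
  simpa [addT, app2] using recS_zero 1 (v 0) (succT (v 1)) ![t]

theorem succ_add (s t : Tm) : Derives T Γ (Fml.eq (addT (succT s) t) (succT (addT s t))) := by
  simpa [addT, app2] using recS_succ 1 (v 0) (succT (v 1)) s ![t]

theorem tri_zero : Derives T Γ (Fml.eq (triT zeroT) zeroT) := by
  simpa [triT, app1] using recS_zero 0 zeroT (succT (addT (v 1) (v 0))) ![]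

theorem tri_succ (t : Tm) :
    Derives T Γ (Fml.eq (triT (succT t)) (succT (addT (triT t) t))) := by
  simpa [triT, app1] using recS_succ 0 zeroT (succT (addT (v 1) (v 0))) t ![]

theorem diag_zero : Derives T Γ (Fml.eq (diagT zeroT) zeroT) := by
  simpa [diagT, app1] using recS_zero 0 zeroT
    (iteT (eqT (v 0) (addT (triT (v 1)) (v 1))) (succT (v 1)) (v 1)) ![]

theorem diag_succ (t : Tm) : Derives T Γ (Fml.eq (diagT (succT t))
    (iteT (eqT t (addT (triT (diagT t)) (diagT t))) (succT (diagT t)) (diagT t))) := by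
  simpa [diagT, app1] using recS_succ 0 zeroT
    (iteT (eqT (v 0) (addT (triT (v 1)) (v 1))) (succT (v 1)) (v 1)) t ![]

theorem drop_zero (w : Tm) : Derives T Γ (Fml.eq (dropT zeroT w) w) := by
  simpa [dropT, app2] using recS_zero 1 (v 0) (sndT (v 1)) ![w]

theorem drop_succ (i w : Tm) :
    Derives T Γ (Fml.eq (dropT (succT i) w) (sndT (dropT i w))) := by
  simpa [dropT, app2] using recS_succ 1 (v 0) (sndT (v 1)) i ![w]

theorem add_zero (t : Tm) : Derives T Γ (Fml.eq (addT t zeroT) t) := by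
  have := induct (T := T) (Γ := Γ) (φ := Fml.eq (addT (v 0) zeroT) (v 0))
    (by simpa using zero_add _)
    (by simpa using (succ_add _ _).eqTrans (succ_congr h0)) (scons t v)
  simpa using this

theorem add_succ (s t : Tm) : Derives T Γ (Fml.eq (addT s (succT t)) (succT (addT s t))) := by
  have := induct (T := T) (Γ := Γ)
    (φ := Fml.eq (addT (v 0) (succT (v 1))) (succT (addT (v 0) (v 1))))
    (by simpa using (zero_add _).eqTrans (succ_congr (zero_add _).eqSymm))
    (by simpa using (succ_add _ _).eqTrans (succ_congr (h0.eqTrans (succ_add _ _).eqSymm)))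
    (scons s (scons t v))
  simpa using this

theorem add_sub_cancel (s t : Tm) : Derives T Γ (Fml.eq (subT (addT s t) s) t) := by
  have := induct (T := T) (Γ := Γ) (φ := Fml.eq (subT (addT (v 0) (v 1)) (v 0)) (v 1))
    (by simpa using (sub_zero _).eqTrans (zero_add _))
    (by simpa using (sub_congr (succ_add _ _) (eqRefl _)).eqTrans (succ_sub_succ _ _) |>.eqTrans h0)
    (scons s (scons t v))
  simpa using this

theorem sub_add_self (s t : Tm) : Derives T Γ (Fml.eq (subT s (addT s t)) zeroT) := by
  have := induct (T := T) (Γ := Γ) (φ := Fml.eq (subT (v 0) (addT (v 0) (v 1))) zeroT)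
    (by simpa using zero_sub _)
    (by simpa using (sub_congr (eqRefl _) (succ_add _ _)).eqTrans (succ_sub_succ _ _) |>.eqTrans h0)
    (scons s (scons t v))
  simpa using this

theorem add_left_cancel (h : Derives T Γ (Fml.eq (addT r s) (addT r t))) :
    Derives T Γ (Fml.eq s t) :=
  (add_sub_cancel r s).eqSymm.eqTrans ((sub_congr h (eqRefl _)).eqTrans (add_sub_cancel r t))

theorem diag_succ_of_eq (h : Derives T Γ (Fml.eq t (addT (triT (diagT t)) (diagT t)))) :
    Derives T Γ (Fml.eq (diagT (succT t)) (succT (diagT t))) :=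
  (diag_succ t).eqTrans (ite_zero (eqT_iff.mp h))

theorem diag_succ_of_ne
    (h : Derives T Γ (Fml.neg (Fml.eq t (addT (triT (diagT t)) (diagT t))))) :
    Derives T Γ (Fml.eq (diagT (succT t)) (diagT t)) :=
  (diag_succ t).eqTrans
    (zeroCases (eqT t (addT (triT (diagT t)) (diagT t))) (botE' h.wk (eqT_iff.mpr h0)) (ite_succ h0))

/-- The diagonal index stays constant from position `triT t` to `triT t + t`. Its value at the start
is a hypothesis, because `diag_tri` obtains that by an induction which uses this lemma to reach the
end of each diagonal. -/
theorem diag_tri_add_of_diag_tri (h : Derives T Γ (Fml.eq (diagT (triT t)) t))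
    (h' : Derives T Γ (Fml.eq (subT s t) zeroT)) :
    Derives T Γ (Fml.eq (diagT (addT (triT t) s)) t) := by
  have := induct (T := T) (Γ := Γ)
    (φ := Fml.imp (Fml.eq (diagT (triT (v 1))) (v 1)) (Fml.imp (Fml.eq (subT (v 0) (v 1)) zeroT)
      (Fml.eq (diagT (addT (triT (v 1)) (v 0))) (v 1))))
    (by
      refine impI (impI ?_)
      simpa using (diag_congr (add_zero _)).eqTrans h1)
    (by
      refine impI (impI ?_)
      simp
      refine cut (impE (impE h2 h1) (sub_eq_zero_of_lt h0)) ?_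
      refine (diag_congr (add_succ _ _)).eqTrans ((diag_succ_of_ne (negI ?_)).eqTrans h0)
      -- The index jumps only at the last position, s = t, where s + 1 - t would be 1; but s + 1 ≤
      -- t.
      refine succ_absurd (s := zeroT) h2
        ((sub_congr (succ_congr ?_) (eqRefl _)).eqTrans (succ_sub_self (v 1)))
      exact add_left_cancel (h0.eqTrans (add_congr (tri_congr h1) h1)))
    (scons s (scons t v))
  exact impE (impE (by simpa using this) h) h'

theorem diag_tri (t : Tm) : Derives T Γ (Fml.eq (diagT (triT t)) t) := by
  have := induct (T := T) (Γ := Γ) (φ := Fml.eq (diagT (triT (v 0))) (v 0))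
    (by simpa using (diag_congr tri_zero).eqTrans diag_zero)
    (by
      simp
      refine cut (diag_tri_add_of_diag_tri h0 (sub_self _)) ?_
      refine (diag_congr (tri_succ _)).eqTrans ((diag_succ_of_eq ?_).eqTrans (succ_congr h0))
      exact (add_congr (tri_congr h0) h0).eqSymm)
    (scons t v)
  simpa using this

theorem diag_pair (s t : Tm) : Derives T Γ (Fml.eq (diagT (pairT s t)) (addT s t)) :=
  diag_tri_add_of_diag_tri (diag_tri _) (sub_add_self _ _)

theorem fst_pair (s t : Tm) : Derives T Γ (Fml.eq (fstT (pairT s t)) s) :=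
  (sub_congr (eqRefl _) (tri_congr (diag_pair s t))).eqTrans (add_sub_cancel _ _)

theorem snd_pair (s t : Tm) : Derives T Γ (Fml.eq (sndT (pairT s t)) t) :=
  (sub_congr (diag_pair s t) (fst_pair s t)).eqTrans (add_sub_cancel _ _)

/-- The recursion applies `sndT` outermost; taking the head off a pair requires one application
innermost. -/
theorem drop_succ' (i w : Tm) :
    Derives T Γ (Fml.eq (dropT (succT i) w) (dropT i (sndT w))) := by
  have := induct (T := T) (Γ := Γ)
    (φ := Fml.eq (dropT (succT (v 0)) (v 1)) (dropT (v 0) (sndT (v 1))))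
    (by simpa using (drop_succ _ _).eqTrans ((snd_congr (drop_zero _)).eqTrans (drop_zero _).eqSymm))
    (by simpa using (drop_succ _ _).eqTrans ((snd_congr h0).eqTrans (drop_succ _ _).eqSymm))
    (scons i (scons w v))
  simpa using this

theorem entry_pair_zero (s t : Tm) : Derives T Γ (Fml.eq (entryT (pairT s t) zeroT) s) :=
  (fst_congr (drop_zero _)).eqTrans (fst_pair s t)

theorem entry_pair_succ (s t i : Tm) :
    Derives T Γ (Fml.eq (entryT (pairT s t) (succT i)) (entryT t i)) :=
  fst_congr ((drop_succ' _ _).eqTrans (drop_congr (eqRefl _) (snd_pair s t)))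

end Derives

/-! ### Bounded choice -/

namespace Derives

variable {T : Set Fml} {Γ : List Fml} {φ ψ χ : Fml} [hT : ExtendsHA T]

/-- Finite choice: `∀ y < x ∃ z φ` is equivalent to the existence of a list that contains a witness
for every `y < x`. -/
theorem ball_ex (φ : Fml) (x : ℕ) : Derives T Γ (Fml.iff (Fml.ball x (Fml.ex φ))
    (Fml.ex (Fml.ball (x + 1) (φ.subst (scons (entryT (v 1) (subT (v (x + 1 + 1)) (succT (v 0))))
      (scons (v 0) (sh 2))))))) := by
  refine iffI ?_ ?_
  -- The bound becomes a fresh induction variable, kept apart from occurrences of x in φ (hence `sh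
  -- 3`), and is set to `v x` at the end.
  · have := induct (T := T) (Γ := Fml.ball x (Fml.ex φ) :: Γ)
      (φ := Fml.imp
        (Fml.all (Fml.imp (Fml.lt (v 0) (v 1)) (Fml.ex (φ.subst (scons (v 0) (scons (v 1) (sh 3)))))))
        (Fml.ex (Fml.all (Fml.imp (Fml.lt (v 0) (v 2))
          (φ.subst (scons (entryT (v 1) (subT (v 2) (succT (v 0)))) (scons (v 0) (sh 3))))))))
      (by
        refine impI (exI zeroT ?_)
        simp
        exact allI (impI (not_lt_zero h0)))
      (by
        refine impI ?_
        simp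
        refine cut (impE (allE_eq (v 0) h0 (by simp; exact ⟨rfl, rfl⟩)) (lt_succ_of_eq (eqRefl _))) ?_
        refine exE h0 ?_
        simp
        refine exE (impE h3 (allI (impI ?_))) ?_
        · simp
          exact impE (allE_eq (v 0) h3 (by simp)) (lt_succ_of_lt h0)
        simp
        -- The witness for the newest y is put at the head of the list for the smaller ones. So y
        -- sits at position x - (y + 1), and raising x moves every old entry by one.
        refine exI (pairT (v 1) (v 0)) ?_
        simp
        refine allI (impI (orE (lt_or_eq_of_lt_succ h0) ?_ ?_))
        · simp
          refine replace (s := entryT (v 1) (subT (v 3) (succT (v 0)))) (eqSymm ?_)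
            (impE (allE_eq (v 0) h2 (by simp)) h0)
          exact (entry_congr (eqRefl _) ((succ_sub_succ _ _).eqTrans (sub_eq_succ_of_lt h0))).eqTrans
            (entry_pair_succ _ _ _)
        · simp
          refine replace (s := v 2) (eqSymm ?_) ?_
          · refine (entry_congr (eqRefl _) ?_).eqTrans (entry_pair_zero _ _)
            exact (succ_sub_succ _ _).eqTrans ((sub_congr (eqRefl _) h0).eqTrans (sub_self _))
          · exact replace_eq (φ.subst (scons (v 3) (scons (v 0) (sh 5)))) h0.eqSymm h3
              (by simp) (by simp))
      (scons (v x) v)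
    refine impE ?_ (h0 (φ := Fml.ball x (Fml.ex φ)))
    simpa [Fml.ball] using this
  · refine exE h0 ?_
    simp [Fml.ball]
    refine allI (impI (exI (entryT (v 1) (subT (v (x + 1 + 1)) (succT (v 0)))) ?_))
    simp
    exact impE (allE_eq (v 0) h1 (by simp)) h0

end Derives

/-! ### Free variables -/

@[simp] theorem mem_varFinset_v {z n : ℕ} : z ∈ (v n).varFinset ↔ z = n := by
  simp [v, Term.varFinset]

@[simp] theorem mem_varFinset_app {z n : ℕ} (f : PRSymbol n) (ts : Fin n → Tm) :
    z ∈ (app f ts).varFinset ↔ ∃ i, z ∈ (ts i).varFinset := by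
  simp only [app, Term.varFinset, Finset.mem_biUnion, Finset.mem_univ, true_and]

@[simp] theorem mem_varFinset_zeroT {z : ℕ} : ¬ z ∈ zeroT.varFinset := by
  simp [zeroT]

@[simp] theorem mem_varFinset_succT {z : ℕ} (t : Tm) :
    z ∈ (succT t).varFinset ↔ z ∈ t.varFinset := by
  simp [succT]

@[simp] theorem mem_varFinset_app1 {z : ℕ} (f : PRSymbol 1) (t : Tm) :
    z ∈ (app1 f t).varFinset ↔ z ∈ t.varFinset := by
  simp [app1]

@[simp] theorem mem_varFinset_app2 {z : ℕ} (f : PRSymbol 2) (s t : Tm) :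
    z ∈ (app2 f s t).varFinset ↔ z ∈ s.varFinset ∨ z ∈ t.varFinset := by
  simp [app2, Fin.exists_fin_two]

theorem mem_varFinset_subst {z : ℕ} (t : Tm) (σ : ℕ → Tm) (h : z ∈ (t.subst σ).varFinset) :
    ∃ m ∈ t.varFinset, z ∈ (σ m).varFinset := by
  induction t with
  | var n => exact ⟨n, by simp [Term.varFinset], h⟩
  | func f ts ih =>
    obtain ⟨i, hi⟩ := (mem_varFinset_app f (fun i => (ts i).subst σ)).1 h
    obtain ⟨m, hm, hz⟩ := ih i hi
    exact ⟨m, (mem_varFinset_app f ts).2 ⟨i, hm⟩, hz⟩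

namespace Fml

theorem mem_fv_quantifier {s : Finset ℕ} {z : ℕ} :
    z ∈ (s.erase 0).image Nat.pred ↔ z + 1 ∈ s := by
  simp only [Finset.mem_image, Finset.mem_erase]
  constructor
  · rintro ⟨a, ⟨h0, ha⟩, rfl⟩
    rwa [← Nat.succ_eq_add_one, Nat.succ_pred h0]
  · exact fun h => ⟨z + 1, ⟨by simp, h⟩, rfl⟩

@[simp] theorem mem_fv_all {φ : Fml} {z : ℕ} : z ∈ (all φ).fv ↔ z + 1 ∈ φ.fv :=
  mem_fv_quantifier
@[simp] theorem mem_fv_ex {φ : Fml} {z : ℕ} : z ∈ (ex φ).fv ↔ z + 1 ∈ φ.fv :=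
  mem_fv_quantifier
@[simp] theorem mem_fv_bot {z : ℕ} : ¬ z ∈ bot.fv := by simp [fv]
@[simp] theorem mem_fv_eq {s t : Tm} {z : ℕ} :
    z ∈ (eq s t).fv ↔ z ∈ s.varFinset ∨ z ∈ t.varFinset := by simp [fv]
@[simp] theorem mem_fv_and {φ ψ : Fml} {z : ℕ} : z ∈ (and φ ψ).fv ↔ z ∈ φ.fv ∨ z ∈ ψ.fv := by
  simp [fv]
@[simp] theorem mem_fv_or {φ ψ : Fml} {z : ℕ} : z ∈ (or φ ψ).fv ↔ z ∈ φ.fv ∨ z ∈ ψ.fv := by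
  simp [fv]
@[simp] theorem mem_fv_imp {φ ψ : Fml} {z : ℕ} : z ∈ (imp φ ψ).fv ↔ z ∈ φ.fv ∨ z ∈ ψ.fv := by
  simp [fv]

theorem mem_fv_subst {φ : Fml} {σ : ℕ → Tm} {z : ℕ} (h : z ∈ (φ.subst σ).fv) :
    ∃ m ∈ φ.fv, z ∈ (σ m).varFinset := by
  induction φ generalizing σ z with
  | bot => simp at h
  | eq s t =>
    simp only [eq_subst, mem_fv_eq] at h ⊢
    rcases h with h | h
    · obtain ⟨m, hm, hz⟩ := mem_varFinset_subst _ _ h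
      exact ⟨m, Or.inl hm, hz⟩
    · obtain ⟨m, hm, hz⟩ := mem_varFinset_subst _ _ h
      exact ⟨m, Or.inr hm, hz⟩
  | and φ ψ ih₁ ih₂ | or φ ψ ih₁ ih₂ | imp φ ψ ih₁ ih₂ =>
    simp only [and_subst, or_subst, imp_subst, mem_fv_and, mem_fv_or, mem_fv_imp] at h ⊢
    rcases h with h | h
    · obtain ⟨m, hm, hz⟩ := ih₁ h
      exact ⟨m, Or.inl hm, hz⟩
    · obtain ⟨m, hm, hz⟩ := ih₂ h
      exact ⟨m, Or.inr hm, hz⟩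
  | all φ ih | ex φ ih =>
    simp only [all_subst, ex_subst, mem_fv_all, mem_fv_ex] at h ⊢
    obtain ⟨m, hm, hz⟩ := ih h
    cases m with
    | zero => simp at hz
    | succ m =>
      obtain ⟨j, hj, hzj⟩ := mem_varFinset_subst _ _ hz
      obtain rfl : z = j := by simpa using hzj
      exact ⟨m, hm, hj⟩

theorem IsQF.subst {φ : Fml} (h : φ.IsQF) (σ : ℕ → Tm) : (φ.subst σ).IsQF := by
  induction φ with
  | bot | eq => trivial
  | and φ ψ ih₁ ih₂ | or φ ψ ih₁ ih₂ | imp φ ψ ih₁ ih₂ => exact ⟨ih₁ h.1, ih₂ h.2⟩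
  | all | ex => exact h.elim

/-! ### Characteristic terms of quantifier-free formulas -/

/-- A term that has the value `0` if and only if the quantifier-free formula holds. -/
def chi : Fml → Tm
  | bot => succT zeroT
  | eq s t => eqT s t
  | and φ ψ => andT (chi φ) (chi ψ)
  | or φ ψ => orT (chi φ) (chi ψ)
  | imp φ ψ => impT (chi φ) (chi ψ)
  | all _ => zeroT
  | ex _ => zeroT

theorem mem_fv_of_mem_chi {φ : Fml} {z : ℕ} (h : z ∈ φ.chi.varFinset) : z ∈ φ.fv := by
  induction φ with
  | bot | all | ex => simp [chi] at h
  | eq s t =>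
    simp only [chi, eqT, andT, subT, mem_varFinset_app2, mem_fv_eq] at h ⊢
    tauto
  | and φ ψ ih₁ ih₂ | or φ ψ ih₁ ih₂ | imp φ ψ ih₁ ih₂ =>
    simp only [chi, andT, orT, impT, mem_varFinset_app2, mem_fv_and, mem_fv_or, mem_fv_imp] at h ⊢
    tauto

end Fml

namespace Derives

variable {T : Set Fml} {Γ : List Fml} {φ ψ χ : Fml} [hT : ExtendsHA T]

theorem chi_iff (h : φ.IsQF) : Derives T Γ (Fml.iff φ (Fml.eq φ.chi zeroT)) := by
  induction φ with
  | bot => exact iffI (botE h0) (negE (succ_ne_zero zeroT) h0)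
  | eq s t => exact eqT_iff
  | and φ ψ ih₁ ih₂ => exact (and_congr (ih₁ h.1) (ih₂ h.2)).iffTrans andT_iff
  | or φ ψ ih₁ ih₂ => exact (or_congr (ih₁ h.1) (ih₂ h.2)).iffTrans orT_iff
  | imp φ ψ ih₁ ih₂ => exact (imp_congr (ih₁ h.1) (ih₂ h.2)).iffTrans impT_iff
  | all | ex => exact h.elim

/-- Decidability is read off the value of the characteristic term: zero or a successor. -/
theorem em_of_isQF (h : φ.IsQF) : Derives T Γ (Fml.or φ (Fml.neg φ)) :=
  zeroCases φ.chi (orI₁ ((chi_iff h).mpr h0))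
    (orI₂ (negI (succ_absurd ((chi_iff h).mp h0) h1)))

theorem neg_neg_elim_of_isQF (h : φ.IsQF) (h' : Derives T Γ (Fml.neg (Fml.neg φ))) :
    Derives T Γ φ := orE (em_of_isQF h) h0 (botE' h'.wk h0)

end Derives

/-! ### Bounded quantification of quantifier-free formulas -/

@[simp] theorem app_cons_subst {n : ℕ} (f : PRSymbol (n + 1)) (t : Tm) (ts : Fin n → Tm)
    (σ : ℕ → Tm) : (app f (Fin.cons t ts)).subst σ =
      app f (Fin.cons (t.subst σ) (fun i => (ts i).subst σ)) := by
  rw [app_subst]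
  congr 1
  funext i
  cases i using Fin.cases <;> rfl

@[simp] theorem env_compS {n : ℕ} (ts : Fin n → Tm) (σ : ℕ → Tm) :
    compS (env ts) σ = env (fun i => (ts i).subst σ) := by
  funext i
  by_cases h : i < n <;> simp [env, h]

/-- A symbol for the function of `r, z₀, ..., zₙ₋₁` that has the value `0` if and only if
`t(y, z₀, ..., zₙ₋₁) = 0` for all `y < r`. -/
def boundedS (n : ℕ) (t : Tm) : PRSymbol (n + 1) :=
  recS n zeroT (andT (v 1) (t.subst (scons (v 0) (sh 2))))

namespace Derives

variable {T : Set Fml} {Γ : List Fml} {φ ψ χ : Fml} [hT : ExtendsHA T]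

theorem boundedS_zero (n : ℕ) (t : Tm) (ts : Fin n → Tm) :
    Derives T Γ (Fml.eq (app (boundedS n t) (Fin.cons zeroT ts)) zeroT) := by
  simpa [boundedS] using recS_zero n zeroT (andT (v 1) (t.subst (scons (v 0) (sh 2)))) ts

theorem boundedS_succ (n : ℕ) (t r : Tm) (ts : Fin n → Tm) :
    Derives T Γ (Fml.eq (app (boundedS n t) (Fin.cons (succT r) ts))
      (andT (app (boundedS n t) (Fin.cons r ts)) (t.subst (scons r (env ts))))) := by
  simpa [boundedS] using recS_succ n zeroT (andT (v 1) (t.subst (scons (v 0) (sh 2)))) r ts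

/-- The parameters `ts` may contain x, so the induction runs over a fresh bound with `ts` shifted
past it. -/
theorem ball_eq_zero (n : ℕ) (t : Tm) (ts : Fin n → Tm) (x : ℕ) :
    Derives T Γ (Fml.iff
      (Fml.ball x (Fml.eq (t.subst (scons (v 0) (env fun i => (ts i).subst (sh 1)))) zeroT))
      (Fml.eq (app (boundedS n t) (Fin.cons (v x) ts)) zeroT)) := by
  have := induct (T := T) (Γ := Γ)
    (φ := Fml.iff
      (Fml.all (Fml.imp (Fml.lt (v 0) (v 1))
        (Fml.eq (t.subst (scons (v 0) (env fun i => (ts i).subst (sh 2)))) zeroT)))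
      (Fml.eq (app (boundedS n t) (Fin.cons (v 0) (fun i => (ts i).subst (sh 1)))) zeroT))
    (by
      simp [-app_subst]
      exact iffI (boundedS_zero _ _ _) (allI (impI (not_lt_zero h0))))
    (by
      simp [-app_subst]
      refine iffTrans (iffI ?_ ?_) (iffTrans andT_iff (iffI
        ((boundedS_succ _ _ _ _).eqTrans h0) ((boundedS_succ _ _ _ _).eqSymm.eqTrans h0)))
      · refine andI (h1.mp (allI (impI ?_))) ?_
        · simp
          exact impE (allE_eq (v 0) h1 (by simp)) (lt_succ_of_lt h0)
        · exact impE (allE_eq (v 0) h0 (by simp; rfl)) (lt_succ_of_eq (eqRefl _))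
      · refine cut (h1.mpr (andE₁ h0)) (allI (impI ?_))
        simp [-app_subst]
        refine orE (lt_or_eq_of_lt_succ h0) ?_ ?_
        · exact impE (allE_eq (v 0) h2 (by simp)) h0
        · exact replace_eq (Fml.eq (t.subst (scons (v 0) (env fun i => (ts i).subst (sh 3)))) zeroT)
            h0.eqSymm (andE₂ h3) (by simp) (by simp))
    (scons (v x) v)
  simpa [Fml.ball, -app_subst] using this

end Derives

/-- Bounded universal quantification of a quantifier-free formula. -/
theorem exists_isQF_ball {φ : Fml} (h : φ.IsQF) (x : ℕ) :
    ∃ ψ : Fml, ψ.IsQF ∧ (∀ z ∈ ψ.fv, z = x ∨ z + 1 ∈ φ.fv) ∧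
      Proves HA (Fml.iff (Fml.ball x φ) ψ) := by
  set n := φ.chi.varFinset.sup id with hn
  -- Indices that do not occur in the characteristic term receive 0, so that no new free variables
  -- arise.
  let ts : Fin n → Tm := fun i => if (i : ℕ) + 1 ∈ φ.chi.varFinset then v i else zeroT
  refine ⟨Fml.eq (app (boundedS n φ.chi) (Fin.cons (v x) ts)) zeroT, trivial, fun z hz => ?_, ?_⟩
  · simp only [Fml.mem_fv_eq, mem_varFinset_app, mem_varFinset_zeroT, or_false] at hz
    obtain ⟨i, hi⟩ := hz
    cases i using Fin.cases with
    | zero => exact Or.inl (by simpa using hi)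
    | succ i =>
      by_cases hm : (i : ℕ) + 1 ∈ φ.chi.varFinset
      · have : z = i := by simpa [ts, hm] using hi
        exact Or.inr (Fml.mem_fv_of_mem_chi (this ▸ hm))
      · simp [ts, hm] at hi
  · refine Derives.iffTrans (Derives.all_congr (Derives.imp_congr Derives.iffRefl
      (Derives.chi_iff h))) ?_
    have := Derives.ball_eq_zero (T := HA) (Γ := []) n φ.chi ts x
    rwa [tm_subst_congr (τ := v), tm_subst_v] at this
    intro i hi
    cases i with
    | zero => rfl
    | succ i =>
      have : i < n := Finset.le_sup (f := id) hi
      simp [env, this, ts, hi]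

/-! ### The arithmetical hierarchy -/

namespace Fml

/-- The formula `δ → φ` with `δ` moved inside of the leading quantifiers of `φ`. -/
def guard : Fml → Fml → Fml
  | δ, all φ => all (guard δ.shift φ)
  | δ, ex φ => ex (guard δ.shift φ)
  | δ, bot => imp δ bot
  | δ, eq s t => imp δ (eq s t)
  | δ, and φ ψ => imp δ (and φ ψ)
  | δ, or φ ψ => imp δ (or φ ψ)
  | δ, imp φ ψ => imp δ (imp φ ψ)

theorem mem_fv_shift {φ : Fml} {z : ℕ} (h : z ∈ φ.shift.fv) : ∃ m ∈ φ.fv, z = m + 1 := by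
  obtain ⟨m, hm, hz⟩ := mem_fv_subst h
  exact ⟨m, hm, by simpa using hz⟩

theorem mem_fv_guard {δ φ : Fml} {z : ℕ} (h : z ∈ (guard δ φ).fv) : z ∈ δ.fv ∨ z ∈ φ.fv := by
  induction φ generalizing δ z with
  | bot | eq | and | or | imp => exact mem_fv_imp.1 h
  | all φ ih | ex φ ih =>
    simp only [guard, mem_fv_all, mem_fv_ex] at h ⊢
    rcases ih h with h | h
    · obtain ⟨m, hm, hz⟩ := mem_fv_shift h
      obtain rfl : z = m := by omega
      exact Or.inl hm
    · exact Or.inr h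

theorem guard_iterate_all (n : ℕ) (δ φ : Fml) :
    guard δ (all^[n] φ) = all^[n] (guard (shift^[n] δ) φ) := by
  induction n generalizing δ with
  | zero => rfl
  | succ n ih =>
    rw [Function.iterate_succ_apply', guard, ih, Function.iterate_succ_apply',
      Function.iterate_succ_apply]

theorem guard_iterate_ex (n : ℕ) (δ φ : Fml) :
    guard δ (ex^[n] φ) = ex^[n] (guard (shift^[n] δ) φ) := by
  induction n generalizing δ with
  | zero => rfl
  | succ n ih =>
    rw [Function.iterate_succ_apply', guard, ih, Function.iterate_succ_apply',
      Function.iterate_succ_apply]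

theorem IsQF.iterate_shift {δ : Fml} (h : δ.IsQF) (n : ℕ) : (shift^[n] δ).IsQF := by
  induction n with
  | zero => exact h
  | succ n ih => rw [Function.iterate_succ_apply']; exact ih.subst _

theorem IsQF.guard {δ φ : Fml} (hδ : δ.IsQF) (h : φ.IsQF) : (guard δ φ).IsQF := by
  cases φ with
  | bot | eq | and | or | imp => exact ⟨hδ, h⟩
  | all | ex => exact h.elim

theorem subst_iterate_all (n : ℕ) (φ : Fml) (σ : ℕ → Tm) :
    (all^[n] φ).subst σ = all^[n] (φ.subst (up^[n] σ)) := by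
  induction n generalizing σ with
  | zero => rfl
  | succ n ih =>
    rw [Function.iterate_succ_apply', subst, ih, Function.iterate_succ_apply',
      Function.iterate_succ_apply]

theorem subst_iterate_ex (n : ℕ) (φ : Fml) (σ : ℕ → Tm) :
    (ex^[n] φ).subst σ = ex^[n] (φ.subst (up^[n] σ)) := by
  induction n generalizing σ with
  | zero => rfl
  | succ n ih =>
    rw [Function.iterate_succ_apply', subst, ih, Function.iterate_succ_apply',
      Function.iterate_succ_apply]

end Fml

theorem hierarchy_guard {k : ℕ} {δ φ : Fml} (hδ : δ.IsQF) :
    (φ ∈ SigmaF k → Fml.guard δ φ ∈ SigmaF k) ∧ (φ ∈ PiF k → Fml.guard δ φ ∈ PiF k) := by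
  induction k generalizing δ φ with
  | zero => exact ⟨fun h => hδ.guard h, fun h => hδ.guard h⟩
  | succ k ih =>
    constructor
    · rintro ⟨n, φ, hn, hφ, rfl⟩
      exact ⟨n, _, hn, (ih (hδ.iterate_shift n)).2 hφ, Fml.guard_iterate_ex n δ φ⟩
    · rintro ⟨n, φ, hn, hφ, rfl⟩
      exact ⟨n, _, hn, (ih (hδ.iterate_shift n)).1 hφ, Fml.guard_iterate_all n δ φ⟩

theorem hierarchy_subst {k : ℕ} {φ : Fml} (σ : ℕ → Tm) :
    (φ ∈ SigmaF k → φ.subst σ ∈ SigmaF k) ∧ (φ ∈ PiF k → φ.subst σ ∈ PiF k) := by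
  induction k generalizing φ σ with
  | zero => exact ⟨fun h => Fml.IsQF.subst h σ, fun h => Fml.IsQF.subst h σ⟩
  | succ k ih =>
    constructor
    · rintro ⟨n, φ, hn, hφ, rfl⟩
      exact ⟨n, _, hn, (ih _).2 hφ, Fml.subst_iterate_ex n φ σ⟩
    · rintro ⟨n, φ, hn, hφ, rfl⟩
      exact ⟨n, _, hn, (ih _).1 hφ, Fml.subst_iterate_all n φ σ⟩

theorem all_mem_piF {k : ℕ} {φ : Fml} (h : φ ∈ PiF (k + 1)) : Fml.all φ ∈ PiF (k + 1) := by
  obtain ⟨n, φ, hn, hφ, rfl⟩ := h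
  exact ⟨n + 1, φ, by omega, hφ, (Function.iterate_succ_apply' _ _ _).symm⟩

/-- Moving ∃ out of the consequent is the only step that is not purely logical: it needs δ
decidable, and 0 serves as witness when δ fails. -/
theorem Derives.guard_iff {T : Set Fml} {Γ : List Fml} {δ φ : Fml} [ExtendsHA T] (hδ : δ.IsQF) :
    Derives T Γ (Fml.iff (Fml.guard δ φ) (Fml.imp δ φ)) := by
  induction φ generalizing δ Γ with
  | bot | eq | and | or | imp => exact iffRefl
  | all φ ih =>
    refine (all_congr (ih (δ := δ.shift) (hδ.subst _))).iffTrans (iffI (impI (allI ?_)) (allI (impI ?_)))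
    · simp
      exact impE (allE_eq (v 0) h1 (by simp)) h0
    · simp
      exact allE_eq (v 0) (impE h1 h0) (by simp)
  | ex φ ih =>
    refine (ex_congr (ih (δ := δ.shift) (hδ.subst _))).iffTrans (iffI (impI ?_) (orE (em_of_isQF hδ) ?_ ?_))
    · refine exE h1 ?_
      simp
      exact exI_eq (v 0) (impE h0 h1) (by simp)
    · refine exE (impE h1 h0) ?_
      simp
      exact exI_eq (v 0) (impI h1) (by simp; rfl)
    · exact exI_eq zeroT (impI (botE' h1 h0)) (by simp; rfl)

/-- Heyting arithmetic shows that the classes of the arithmetical hierarchy are closed under bounded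
universal quantification. -/
theorem exists_ball (k : ℕ) :
    (∀ φ ∈ SigmaF k, ∀ x : ℕ, ∃ ψ ∈ SigmaF k, (∀ z ∈ ψ.fv, z = x ∨ z + 1 ∈ φ.fv) ∧
      Proves HA (Fml.iff (Fml.ball x φ) ψ)) ∧
    (∀ φ ∈ PiF k, ∀ x : ℕ, ∃ ψ ∈ PiF k, (∀ z ∈ ψ.fv, z = x ∨ z + 1 ∈ φ.fv) ∧
      Proves HA (Fml.iff (Fml.ball x φ) ψ)) := by
  induction k with
  | zero => exact ⟨fun φ h x => exists_isQF_ball h x, fun φ h x => exists_isQF_ball h x⟩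
  | succ k ih =>
    refine ⟨?_, fun φ h x => ?_⟩
    -- Induction on the length of the ∃-block, with φ and x general because each use of `ball_ex`
    -- substitutes a list entry into the matrix and places one more binder above the bound.
    · have key : ∀ (n : ℕ) (φ : Fml) (x : ℕ), φ ∈ PiF k → ∃ ψ ∈ PiF k,
          (∀ z ∈ (Fml.ex^[n] ψ).fv, z = x ∨ z + 1 ∈ (Fml.ex^[n] φ).fv) ∧
          Proves HA (Fml.iff (Fml.ball x (Fml.ex^[n] φ)) (Fml.ex^[n] ψ)) := by
        intro n
        induction n with
        | zero => exact fun φ x h => ih.2 φ h x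
        | succ n ihn =>
          intro φ x h
          let σ := scons (entryT (v 1) (subT (v (x + 1 + 1)) (succT (v 0)))) (scons (v 0) (sh 2))
          obtain ⟨ψ, hψ, hfv, hd⟩ := ihn (φ.subst (up^[n] σ)) (x + 1) ((hierarchy_subst _).2 h)
          rw [← Fml.subst_iterate_ex] at hfv hd
          simp only [Function.iterate_succ_apply']
          refine ⟨ψ, hψ, fun z hz => ?_, (Derives.ball_ex _ x).iffTrans (Derives.ex_congr hd)⟩
          rw [Fml.mem_fv_ex] at hz
          rcases hfv _ hz with hz | hz
          · exact Or.inl (by omega)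
          · obtain ⟨m, hm, hz⟩ := Fml.mem_fv_subst hz
            -- Index 0 is the old witness, now a list entry whose only outside variable is x; index
            -- 1 is the bounded variable; only later indices come from free variables of φ.
            match m, hm, hz with
            | 0, _, hz =>
              simp only [σ, scons_zero, entryT, fstT, dropT, triT, diagT, subT, mem_varFinset_app1,
                mem_varFinset_app2, mem_varFinset_succT, mem_varFinset_v] at hz
              exact Or.inl (by omega)
            | 1, _, hz =>
              simp [σ] at hz
            | m + 2, hm, hz =>
              obtain rfl : z = m := by simpa [σ] using hz
              exact Or.inr (Fml.mem_fv_ex.2 hm)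
      rintro φ ⟨n, φ, hn, hφ, rfl⟩ x
      obtain ⟨ψ, hψ, hfv, hd⟩ := key n φ x hφ
      exact ⟨_, ⟨n, ψ, hn, hψ, rfl⟩, hfv, hd⟩
    -- The bounded quantifier lengthens the leading ∀-block by one; the induction hypothesis plays
    -- no role here.
    · have hlt : (Fml.lt (v 0) (v (x + 1))).IsQF := trivial
      refine ⟨_, all_mem_piF ((hierarchy_guard hlt).2 h), fun z hz => ?_,
        Derives.all_congr (Derives.guard_iff hlt).iffSymm⟩
      rw [Fml.mem_fv_all] at hz
      rcases Fml.mem_fv_guard hz with hz | hz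
      · have : z = x := by simpa [lt_eq, subT] using hz
        exact Or.inl this
      · exact Or.inr hz

/-! ### Duals of prenex formulas -/

namespace Fml

/-- The classical negation of a formula, moved inside of its leading quantifiers. -/
def dual : Fml → Fml
  | all φ => ex (dual φ)
  | ex φ => all (dual φ)
  | bot => neg bot
  | eq s t => neg (eq s t)
  | and φ ψ => neg (and φ ψ)
  | or φ ψ => neg (or φ ψ)
  | imp φ ψ => neg (imp φ ψ)

theorem mem_fv_dual {φ : Fml} {z : ℕ} : z ∈ φ.dual.fv ↔ z ∈ φ.fv := by
  induction φ generalizing z with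
  | bot | eq | and | or | imp => simp [dual, neg]
  | all φ ih | ex φ ih => simp [dual, ih]

theorem dual_of_isQF {φ : Fml} (h : φ.IsQF) : φ.dual = neg φ := by
  cases φ with
  | bot | eq | and | or | imp => rfl
  | all | ex => exact h.elim

theorem dual_iterate_all (n : ℕ) (φ : Fml) : (all^[n] φ).dual = ex^[n] φ.dual := by
  induction n with
  | zero => rfl
  | succ n ih => rw [Function.iterate_succ_apply', dual, ih, Function.iterate_succ_apply']

theorem dual_iterate_ex (n : ℕ) (φ : Fml) : (ex^[n] φ).dual = all^[n] φ.dual := by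
  induction n with
  | zero => rfl
  | succ n ih => rw [Function.iterate_succ_apply', dual, ih, Function.iterate_succ_apply']

end Fml

theorem hierarchy_dual {k : ℕ} {φ : Fml} :
    (φ ∈ SigmaF k → φ.dual ∈ PiF k) ∧ (φ ∈ PiF k → φ.dual ∈ SigmaF k) := by
  induction k generalizing φ with
  | zero =>
    have : φ.IsQF → φ.dual.IsQF := fun h => by
      rw [Fml.dual_of_isQF h]
      exact ⟨h, trivial⟩
    exact ⟨this, this⟩
  | succ k ih =>
    constructor
    · rintro ⟨n, φ, hn, hφ, rfl⟩
      exact ⟨n, _, hn, ih.2 hφ, Fml.dual_iterate_ex n φ⟩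
    · rintro ⟨n, φ, hn, hφ, rfl⟩
      exact ⟨n, _, hn, ih.1 hφ, Fml.dual_iterate_all n φ⟩

namespace Derives

variable {T : Set Fml} {Γ : List Fml} {φ ψ χ : Fml}

/-- A formula and its dual are contradictory in pure intuitionistic logic; double negation
elimination is used only for converses. -/
theorem neg_dual (h : Derives T Γ φ) : Derives T Γ (Fml.neg φ.dual) := by
  suffices Derives T [] (Fml.imp φ (Fml.neg φ.dual)) from impE (ofNil this) h
  clear h
  induction φ with
  | bot | eq | and | or | imp => exact impI (negI (negE h0 h1))
  | all φ ih =>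
    refine impI (negI (exE h0 ?_))
    simp
    exact negE (impE (ofNil ih) (allE_eq (v 0) h2 (by simp))) h0
  | ex φ ih =>
    refine impI (negI (exE h1 ?_))
    simp
    exact negE (impE (ofNil ih) h0) (allE_eq (v 0) h1 (by simp))

/-- One quantifier step for both halves of `dual_of_neg_of_dne`, since the dual of ∀ begins with ∃.
-/
theorem all_of_neg_ex (h : Derives T [] (Fml.imp (Fml.neg φ) ψ)) :
    Derives T [] (Fml.imp (Fml.neg (Fml.ex φ)) (Fml.all ψ)) := by
  refine impI (allI (impE (ofNil h) (negI ?_)))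
  simp
  exact negE h1 (exI_eq (v 0) h0 (by simp))

/-- Double negation elimination for `Σ_i` formulas with `i < k` shows that a `Σ_k` formula is
equivalent to its dual's negation, and similarly for `Π_k`. -/
theorem dual_of_neg_of_dne [ExtendsHA T] (k : ℕ)
    (hdne : ∀ i < k, ∀ φ ∈ SigmaF i, Derives T [] (Fml.imp (Fml.neg (Fml.neg φ)) φ)) :
    (∀ φ ∈ SigmaF k, Derives T [] (Fml.imp (Fml.neg φ) φ.dual)) ∧
    (∀ φ ∈ PiF k, Derives T [] (Fml.imp (Fml.neg φ.dual) φ)) := by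
  induction k with
  | zero =>
    refine ⟨fun φ h => ?_, fun φ h => ?_⟩
    · rw [Fml.dual_of_isQF h]
      exact impI h0
    · rw [Fml.dual_of_isQF h]
      exact impI (neg_neg_elim_of_isQF h h0)
  | succ k ih =>
    obtain ⟨ihS, ihP⟩ := ih fun i hi => hdne i (by omega)
    have hk := hdne k (by omega)
    -- In both statements the conclusion is a Σ_k formula, so DNE leaves only its double negation,
    -- and that follows from the induction hypothesis for the opposite direction.
    have hP : ∀ φ ∈ PiF k, Derives T [] (Fml.imp (Fml.neg φ) φ.dual) := fun φ h =>
      impI (impE (ofNil (hk _ (hierarchy_dual.2 h))) (negI (negE h1 (impE (ofNil (ihP φ h)) h0))))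
    have hS : ∀ φ ∈ SigmaF k, Derives T [] (Fml.imp (Fml.neg φ.dual) φ) := fun φ h =>
      impI (impE (ofNil (hk _ h)) (negI (negE h1 (impE (ofNil (ihS φ h)) h0))))
    constructor
    · rintro _ ⟨n, φ, -, h, rfl⟩
      induction n with
      | zero => exact hP φ h
      | succ n ihn =>
        rw [Function.iterate_succ_apply']
        exact all_of_neg_ex ihn
    · rintro _ ⟨n, φ, -, h, rfl⟩
      induction n with
      | zero => exact hS φ h
      | succ n ihn =>
        rw [Function.iterate_succ_apply']
        exact all_of_neg_ex ihn

theorem iterate_ex_congr (n : ℕ) (h : Derives T [] (Fml.iff φ ψ)) :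
    Derives T [] (Fml.iff (Fml.ex^[n] φ) (Fml.ex^[n] ψ)) := by
  induction n with
  | zero => exact h
  | succ n ih =>
    rw [Function.iterate_succ_apply', Function.iterate_succ_apply']
    exact ex_congr ih

theorem iterate_all_congr (n : ℕ) (h : Derives T [] (Fml.iff φ ψ)) :
    Derives T [] (Fml.iff (Fml.all^[n] φ) (Fml.all^[n] ψ)) := by
  induction n with
  | zero => exact h
  | succ n ih =>
    rw [Function.iterate_succ_apply', Function.iterate_succ_apply']
    exact all_congr ih

theorem iff_ex_shift : Derives T Γ (Fml.iff φ (Fml.ex φ.shift)) :=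
  iffI (exI_eq zeroT h0 (by simp)) (exE h0 h0)

theorem iff_all_shift : Derives T Γ (Fml.iff φ (Fml.all φ.shift)) :=
  iffI (allI h0) (allE_eq zeroT h0 (by simp))

/-- The classes of the arithmetical hierarchy are cumulative up to equivalence. -/
theorem exists_iff_succ (T : Set Fml) (k : ℕ) :
    (∀ φ ∈ SigmaF k, ∃ ψ ∈ SigmaF (k + 1), Derives T [] (Fml.iff φ ψ)) ∧
    (∀ φ ∈ PiF k, ∃ ψ ∈ PiF (k + 1), Derives T [] (Fml.iff φ ψ)) := by
  induction k with
  | zero =>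
    -- Literal inclusion fails because blocks are nonempty. A vacuous quantifier is added innermost,
    -- so the outer blocks keep their shape.
    exact ⟨fun φ h => ⟨_, ⟨1, φ.shift, le_rfl, Fml.IsQF.subst h _, rfl⟩, iff_ex_shift⟩,
      fun φ h => ⟨_, ⟨1, φ.shift, le_rfl, Fml.IsQF.subst h _, rfl⟩, iff_all_shift⟩⟩
  | succ k ih =>
    constructor
    · rintro _ ⟨n, φ, hn, hφ, rfl⟩
      obtain ⟨ψ, hψ, h⟩ := ih.2 φ hφ
      exact ⟨_, ⟨n, ψ, hn, hψ, rfl⟩, iterate_ex_congr n h⟩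
    · rintro _ ⟨n, φ, hn, hφ, rfl⟩
      obtain ⟨ψ, hψ, h⟩ := ih.1 φ hφ
      exact ⟨_, ⟨n, ψ, hn, hψ, rfl⟩, iterate_all_congr n h⟩

theorem dne_of_le {i j : ℕ} (hij : i ≤ j)
    (hj : ∀ φ ∈ SigmaF j, Derives T [] (Fml.imp (Fml.neg (Fml.neg φ)) φ)) :
    ∀ φ ∈ SigmaF i, Derives T [] (Fml.imp (Fml.neg (Fml.neg φ)) φ) := by
  induction hij using Nat.decreasingInduction with
  | self => exact hj
  | of_succ i _ ih =>
    intro φ hφ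
    obtain ⟨ψ, hψ, h⟩ := (exists_iff_succ T i).1 φ hφ
    exact impI (mpr (ofNil h) (impE (ofNil (ih ψ hψ))
      (mp (neg_congr (neg_congr (ofNil h))) h0)))

/-- De Morgan's law for `Σ_k` formulas gives a counterexample below `x` for a `Σ_k` formula that does
not hold for all numbers below `x`. -/
theorem bex_neg_of_neg_ball [ExtendsHA T] {k : ℕ}
    (hdml : ∀ φ ∈ SigmaF k, ∀ ψ ∈ SigmaF k, Derives T []
      (Fml.imp (Fml.neg (Fml.and φ ψ)) (Fml.or (Fml.neg φ) (Fml.neg ψ))))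
    (hχ : χ ∈ SigmaF k) (x : ℕ) :
    Derives T Γ (Fml.imp (Fml.neg (Fml.ball x χ)) (Fml.bex x (Fml.neg χ))) := by
  -- De Morgan's law is available for Σ_k formulas only, so ∀y<x χ is replaced by an equivalent θ in
  -- Σ_k. The shift makes room for a fresh bound at index 0.
  obtain ⟨θ, hθ, -, hd⟩ := (exists_ball k).1 _ ((hierarchy_subst (scons (v 0) (sh 2))).1 hχ) 0
  replace hd : Derives T [] _ := hd.mono ExtendsHA.sub (List.Subset.refl _)
  have := induct (T := T) (Γ := Γ)
    (φ := Fml.imp (Fml.neg (Fml.ball 0 (χ.subst (scons (v 0) (sh 2)))))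
      (Fml.bex 0 (Fml.neg (χ.subst (scons (v 0) (sh 2))))))
    (by
      refine impI (botE' h0 ?_)
      simp [Fml.ball]
      exact allI (impI (not_lt_zero h0)))
    (by
      refine impI ?_
      -- Index 0 is now the bound, so χ read without its binder is already the instance at y = x.
      refine orE (impE (ofNil (hdml θ hθ χ hχ)) (negI (negE h1 ?_))) ?_ ?_
      · simp [Fml.ball]
        refine cut (mpr (ofNil hd) (andE₁ h0)) (allI (impI ?_))
        simp [Fml.ball]
        refine orE (lt_or_eq_of_lt_succ h0) ?_ ?_
        · exact impE (allE_eq (v 0) h2 (by simp)) h0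
        · exact replace_eq (χ.subst (scons (v 0) (sh 3))) h0.eqSymm (andE₂ h3) (by simp) (by simp)
      · refine exE (impE h2 (mpr (neg_congr (ofNil hd)) h0)) ?_
        simp [Fml.bex]
        exact exI_eq (v 0) (andI (lt_succ_of_lt (andE₁ h0)) (andE₂ h0)) (by simp)
      · simp [Fml.bex]
        exact exI_eq (v 0) (andI (lt_succ_of_eq (eqRefl _)) h0) (by simp; rfl))
    (scons (v x) v)
  simpa [Fml.ball, Fml.bex] using this

/-- Only the direction from right to left uses De Morgan's law. -/
theorem bex_neg_iff [ExtendsHA T] {k : ℕ}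
    (hdml : ∀ φ ∈ SigmaF k, ∀ ψ ∈ SigmaF k, Derives T []
      (Fml.imp (Fml.neg (Fml.and φ ψ)) (Fml.or (Fml.neg φ) (Fml.neg ψ))))
    (hχ : χ ∈ SigmaF k) (x : ℕ) :
    Derives T Γ (Fml.iff (Fml.bex x (Fml.neg χ)) (Fml.neg (Fml.ball x χ))) := by
  refine iffI (negI (exE h1 ?_)) (impE (bex_neg_of_neg_ball hdml hχ x) h0)
  simp [Fml.ball]
  exact negE (andE₂ h0) (impE (allE_eq (v 0) h1 (by simp)) (andE₁ h0))

end Derives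

/-- De Morgan's law for `Σ_k` formulas and double negation elimination for `Σ_i` formulas with `i < k`
show that `Π_k` is closed under bounded existential quantification. -/
theorem exists_bex {T : Set Fml} [ExtendsHA T] {k : ℕ}
    (hdml : ∀ φ ∈ SigmaF k, ∀ ψ ∈ SigmaF k, Derives T []
      (Fml.imp (Fml.neg (Fml.and φ ψ)) (Fml.or (Fml.neg φ) (Fml.neg ψ))))
    (hdne : ∀ i < k, ∀ φ ∈ SigmaF i, Derives T [] (Fml.imp (Fml.neg (Fml.neg φ)) φ))
    {φ : Fml} (h : φ ∈ PiF k) (x : ℕ) :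
    ∃ ψ ∈ PiF k, (∀ z ∈ ψ.fv, z = x ∨ z + 1 ∈ φ.fv) ∧ Proves T (Fml.iff (Fml.bex x φ) ψ) := by
  have hχ := hierarchy_dual.2 h
  obtain ⟨θ, hθ, hfv, hd⟩ := (exists_ball k).1 _ hχ x
  obtain ⟨hS, hP⟩ := Derives.dual_of_neg_of_dne k hdne
  refine ⟨θ.dual, hierarchy_dual.1 hθ, fun z hz => ?_, ?_⟩
  · simpa [Fml.mem_fv_dual] using hfv z (Fml.mem_fv_dual.1 hz)
  have h₁ : Derives T [] (Fml.iff φ (Fml.neg φ.dual)) :=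
    Derives.iffI Derives.h0.neg_dual (Derives.impE (Derives.ofNil (hP φ h)) Derives.h0)
  have h₂ : Derives T [] (Fml.iff (Fml.neg θ) θ.dual) :=
    Derives.iffI (Derives.impE (Derives.ofNil (hS θ hθ)) Derives.h0)
      (Derives.negI (Derives.negE (Derives.h0.neg_dual) Derives.h1))
  exact (Derives.ex_congr (Derives.and_congr Derives.iffRefl h₁)).iffTrans
    ((Derives.bex_neg_iff hdml hχ x).iffTrans
      ((Derives.neg_congr (hd.mono ExtendsHA.sub (List.Subset.refl _))).iffTrans h₂))

end HeytingArithmetic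

-- The closure properties in the stated theories

theorem mainTheorem5 (k : ℕ) :
    (∀ φ ∈ HeytingArithmetic.PiF k, ∀ x : ℕ, ∃ ψ ∈ HeytingArithmetic.PiF k,
      (∀ z ∈ ψ.fv, z = x ∨ z + 1 ∈ φ.fv) ∧
      HeytingArithmetic.Proves
        (HeytingArithmetic.plus
          (HeytingArithmetic.plus HeytingArithmetic.HA
            (HeytingArithmetic.DML (HeytingArithmetic.SigmaZ (k : ℤ))))
          (HeytingArithmetic.DNE (HeytingArithmetic.SigmaZ ((k : ℤ) - 1))))
        (HeytingArithmetic.Fml.iff (HeytingArithmetic.Fml.bex x φ) ψ)) ∧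
    (∀ φ ∈ HeytingArithmetic.SigmaF k, ∀ x : ℕ, ∃ ψ ∈ HeytingArithmetic.SigmaF k,
      (∀ z ∈ ψ.fv, z = x ∨ z + 1 ∈ φ.fv) ∧
      HeytingArithmetic.Proves
        (HeytingArithmetic.plus
          (HeytingArithmetic.plus HeytingArithmetic.HA
            (HeytingArithmetic.DML (HeytingArithmetic.SigmaZ ((k : ℤ) - 1))))
          (HeytingArithmetic.DNE (HeytingArithmetic.SigmaZ ((k : ℤ) - 2))))
        (HeytingArithmetic.Fml.iff (HeytingArithmetic.Fml.ball x φ) ψ)) := by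
  have hsub : ∀ P Q, HeytingArithmetic.HA ⊆
      HeytingArithmetic.plus (HeytingArithmetic.plus HeytingArithmetic.HA P) Q :=
    fun _ _ => Set.subset_union_left.trans Set.subset_union_left
  constructor
  · intro φ hφ x
    have : HeytingArithmetic.ExtendsHA _ := ⟨hsub
      (HeytingArithmetic.DML (HeytingArithmetic.SigmaZ (k : ℤ)))
      (HeytingArithmetic.DNE (HeytingArithmetic.SigmaZ ((k : ℤ) - 1)))⟩
    refine HeytingArithmetic.exists_bex (fun φ hφ ψ hψ => ?_) (fun i hi => ?_) hφ x
    · exact HeytingArithmetic.Derives.instance_of_closure_mem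
        (Or.inl (Or.inr ⟨_, ⟨φ, hφ, ψ, hψ, rfl⟩, rfl⟩))
    -- DNE is given at level k - 1 alone and passed down to i. Natural subtraction is harmless: i <
    -- k forces k ≥ 1, and for k = 0 there is nothing to show.
    · refine HeytingArithmetic.Derives.dne_of_le (j := k - 1) (by omega) fun φ hφ => ?_
      refine HeytingArithmetic.Derives.instance_of_closure_mem (Or.inr ⟨_, ⟨φ, ?_, rfl⟩, rfl⟩)
      rwa [show (k : ℤ) - 1 = ((k - 1 : ℕ) : ℤ) by omega]
  · intro φ hφ x
    obtain ⟨ψ, hψ, hfv, hd⟩ := (HeytingArithmetic.exists_ball k).1 φ hφ x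
    exact ⟨ψ, hψ, hfv, hd.mono (hsub _ _) (List.Subset.refl _)⟩
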